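/- **Setting.** There are $N\ge 1$ arms; pulling arm $i$ yields a reward drawn from a distribution $\mathcal D_i$ on $[0,1]$ with mean $\mu_i$, and all rewards are independent. Let $\mu^*=\max_i\mu_i$ and $\Delta_i=\mu^*-\mu_i$. Given integers $b\ge 0$, $T$ and a real $c\ge 1$, the *Modified Thompson Sampling algorithm with Gaussian priors* runs for $T$ rounds. It keeps for every arm $i$ a pull count $n_i$ and an estimate $\hat\mu_i$, both initially $0$; whenever arm $i$ is pulled with reward $r$, it sets $\hat\mu_i\leftarrow\frac{\hat\mu_i(n_i+1)+r}{n_i+2}$ and then $n_i\leftarrow n_i+1$. In the first $bN$ rounds it pulls each arm $b$ times. In each of the remaining $T-bN$ rounds it draws independently $\theta_i\sim\mathcal N\big(\hat\mu_i,\frac{c}{n_i+1}\big)$ for all $i$ and pulls an arm that maximizes $\theta_i$ (ties being broken by any measurable rule). Let $n_{i,T}$ be the number of pulls of arm $i$ in all $T$ rounds, let $r_t$ be the reward of round $t$, and let $\mathbb E[\mathcal R(T)]=\mu^*T-\mathbb E\big[\sum_{t=1}^T r_t\big]$ be the expected regret. **Theorem.** There is a universal constant $C>0$ such that the following holds for all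 such $N,b,c,T,(\mathcal D_i)_{i}$ with $T>bN$ and $T>bN+\dfrac{4}{\Delta_i^2}$ for every arm $i$ with $\Delta_i>0$ (that is, $T>bN+4/\min_{i:\Delta_i>0}\Delta_i^2$). 1. For every arm $i$ with $\Delta_i>0$, $$\mathbb E[n_{i,T}]\le b+\frac{14}{\Delta_i^2}+\frac{5130\,c}{\Delta_i^2}\log\big((T-bN)\Delta_i^2\big).$$ 2. (Problem-independent bound) $\displaystyle \mathbb E[\mathcal R(T)]\le bN+C\,c\sqrt{N(T-bN)\log N}.$ 3. (Problem-dependent bound) $\displaystyle \mathbb E[\mathcal R(T)]\le bN+\sum_{i:\Delta_i>0}C\,\frac{c\log(T-bN)}{\Delta_i}.$ -/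

import Mathlib

open MeasureTheory ProbabilityTheory

noncomputable section

namespace ModifiedTS

/-- The statistics kept by the algorithm: for each arm, the number of pulls so far and the
(prior-offset) empirical mean of its rewards. -/
structure State (N : ℕ) where
  count : Fin N → ℕ
  muHat : Fin N → ℝ

/-- All counts and all means start at zero. -/
def State.init (N : ℕ) : State N where
  count := fun _ => 0
  muHat := fun _ => 0

/-- Pull arm `a`, receive reward `r`: the mean of `a` becomes `(μ̂ (n + 1) + r) / (n + 2)`, its count
becomes `n + 1`, and nothing changes for the other arms. -/
def State.pull {N : ℕ} (st : State N) (a : Fin N) (r : ℝ) : State N where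
  count := Function.update st.count a (st.count a + 1)
  muHat := Function.update st.muHat a
    ((st.muHat a * ((st.count a : ℝ) + 1) + r) / ((st.count a : ℝ) + 2))

/-- The posterior sample of arm `i`, with law `N(μ̂ i, c / (n i + 1))` when `z i` is a standard
Gaussian that is independent of the state. -/
def theta {N : ℕ} (c : ℝ) (st : State N) (z : Fin N → ℝ) (i : Fin N) : ℝ :=
  st.muHat i + √(c / ((st.count i : ℝ) + 1)) * z i

/-- `sel` is a (measurable) choice of a maximizing coordinate; ties are broken arbitrarily. -/
structure IsArgmaxRule {N : ℕ} (sel : (Fin N → ℝ) → Fin N) : Prop where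
  measurable : Measurable sel
  le_sel : ∀ (v : Fin N → ℝ) (j : Fin N), v j ≤ v (sel v)

/-- The arm played in round `t = 0, 1, 2, …`. The first `b * N` rounds are the pre-pulls: `b` pulls
of the first arm, then `b` pulls of the second one, and so on. In later rounds it is the arm with
the largest posterior sample. -/
def choose {N : ℕ} (b : ℕ) (c : ℝ) (sel : (Fin N → ℝ) → Fin N) (t : ℕ) (st : State N)
    (z : Fin N → ℝ) : Fin N :=
  if h : t < b * N then ⟨t / b, Nat.div_lt_of_lt_mul h⟩ else sel (theta c st z)

/-- The state after `t` rounds. Here `x i k` is the reward that the `k`-th pull (`k = 0, 1, …`) of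
arm `i` yields, and `z t i` is the Gaussian noise of arm `i` in round `t`. -/
def stateAfter {N : ℕ} (b : ℕ) (c : ℝ) (sel : (Fin N → ℝ) → Fin N) (x : Fin N → ℕ → ℝ)
    (z : ℕ → Fin N → ℝ) : ℕ → State N
  | 0 => State.init N
  | t + 1 =>
    let st := stateAfter b c sel x z t
    let a := choose b c sel t st (z t)
    st.pull a (x a (st.count a))

/-- The arm played in round `t`. -/
def armAt {N : ℕ} (b : ℕ) (c : ℝ) (sel : (Fin N → ℝ) → Fin N) (x : Fin N → ℕ → ℝ)
    (z : ℕ → Fin N → ℝ) (t : ℕ) : Fin N :=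
  choose b c sel t (stateAfter b c sel x z t) (z t)

/-- The reward received in round `t`. -/
def rewardAt {N : ℕ} (b : ℕ) (c : ℝ) (sel : (Fin N → ℝ) → Fin N) (x : Fin N → ℕ → ℝ)
    (z : ℕ → Fin N → ℝ) (t : ℕ) : ℝ :=
  x (armAt b c sel x z t) ((stateAfter b c sel x z t).count (armAt b c sel x z t))

/-- The randomness of a stochastic bandit with reward laws `D` on which the algorithm is run: the
rewards `X i k` of the successive pulls of arm `i` have law `D i`, the noises `Z t i` are standard
Gaussian, and all these random variables are jointly independent. -/
structure IsBanditSample {N : ℕ} {Ω : Type*} [MeasurableSpace Ω] (P : Measure Ω)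
    (D : Fin N → Measure ℝ) (X : Fin N → ℕ → Ω → ℝ) (Z : ℕ → Fin N → Ω → ℝ) : Prop where
  reward_law : ∀ i k, HasLaw (X i k) (D i) P
  noise_law : ∀ t i, HasLaw (Z t i) (gaussianReal 0 1) P
  indep : iIndepFun (Sum.elim (fun p : Fin N × ℕ => X p.1 p.2) (fun p : ℕ × Fin N => Z p.1 p.2)) P

/-- The mean reward of arm `i`. -/
def armMean {N : ℕ} (D : Fin N → Measure ℝ) (i : Fin N) : ℝ := ∫ y, y ∂(D i)

/-- The largest mean reward. -/
def bestMean {N : ℕ} (D : Fin N → Measure ℝ) : ℝ := ⨆ i, armMean D i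

/-- The suboptimality gap of arm `i`. -/
def gap {N : ℕ} (D : Fin N → Measure ℝ) (i : Fin N) : ℝ := bestMean D - armMean D i

/-- The expected number of pulls of arm `i` in the first `T` rounds (pre-pulls included). -/
def expectedPulls {N : ℕ} {Ω : Type*} [MeasurableSpace Ω] (P : Measure Ω) (b : ℕ) (c : ℝ)
    (sel : (Fin N → ℝ) → Fin N) (X : Fin N → ℕ → Ω → ℝ) (Z : ℕ → Fin N → Ω → ℝ) (T : ℕ)
    (i : Fin N) : ℝ :=
  ∫ ω, ((stateAfter b c sel (fun j k => X j k ω) (fun t j => Z t j ω) T).count i : ℝ) ∂P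

/-- The expected regret after `T` rounds (pre-pulls included): `T` times the largest mean reward,
minus the expected total reward. -/
def expectedRegret {N : ℕ} {Ω : Type*} [MeasurableSpace Ω] (P : Measure Ω)
    (D : Fin N → Measure ℝ) (b : ℕ) (c : ℝ) (sel : (Fin N → ℝ) → Fin N)
    (X : Fin N → ℕ → Ω → ℝ) (Z : ℕ → Fin N → Ω → ℝ) (T : ℕ) : ℝ :=
  bestMean D * T -
    ∫ ω, ∑ t ∈ Finset.range T, rewardAt b c sel (fun j k => X j k ω) (fun s j => Z s j ω) t ∂P

end ModifiedTS

end

/-! Fix a bad arm `i` with gap `Δ` and an optimal arm `a`, and put `m = μ_i + Δ/3`, `v = μ_a - Δ/3`,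
so that `v - m = Δ/3`. A later round that plays `i` is charged to one of four causes
(`lintegral_pullCount_le`): the estimate of `i` exceeds `m`; `i` has fewer than about `L` pulls;
both are fine but the posterior sample of `i` exceeds `v`; or that sample is at most `v`. The first
two depend on the round only through the pull count, and each count is used by at most one pull of
`i` (`sum_lintegral_playedArm_le`), so Hoeffding's inequality and counting give `O(1/Δ²)` and `L`.
The third is a Gaussian tail, which `L ≈ c log((T - bN) Δ²) / Δ²` makes small enough to sum over all
rounds.

The fourth cause carries the argument (`measure_playedArm_le`). If the winner `i` has a sample at
most `v`, all samples are at most `v`. Resampling only the noise of `a` trades this event for the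
one where the sample of `a` alone exceeds `v`, at the price of the posterior odds of `a`; there `a`
must be played. Hence the sum over rounds becomes a sum over pull counts `j` of the expected odds
given the first `j` rewards of `a`. These odds grow like the exponential of a squared sub-Gaussian
variable. As `c ≥ 1`, the variance proxy is at most `1/4`, so the expectation is bounded for every
`j` (`lintegral_armOdds_le`) and decays exponentially once `j + 1 ≥ 18c/Δ²`
(`lintegral_armOdds_le_exp`).

For the regret, whether the `k`-th pull of an arm happens is independent of its reward
(`integral_collected_reward`), so regret is the gap-weighted sum of expected pulls. Pre-pulls cost
at most `bN`. Applying the pull bound to every bad arm gives the problem-dependent bound; applying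
it only above the gap threshold `√(N log N / (T - bN))`, and charging that threshold per later pull
below it, gives the other one. -/

namespace ModifiedTS

/-- The estimate that the algorithm forms from the first `k` rewards `x 0, …, x (k - 1)`. -/
noncomputable def offsetMean (x : ℕ → ℝ) (k : ℕ) : ℝ :=
  (∑ l ∈ Finset.range k, x l) / ((k : ℝ) + 1)

/-! ### The algorithm run on fixed rewards and noises. -/

section Deterministic

variable {N : ℕ} (b : ℕ) (c : ℝ) (sel : (Fin N → ℝ) → Fin N)

theorem stateAfter_succ (x : Fin N → ℕ → ℝ) (z : ℕ → Fin N → ℝ) (t : ℕ) :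
    stateAfter b c sel x z (t + 1) =
      (stateAfter b c sel x z t).pull (armAt b c sel x z t) (rewardAt b c sel x z t) := rfl

theorem count_zero (x : Fin N → ℕ → ℝ) (z : ℕ → Fin N → ℝ) (i : Fin N) :
    (stateAfter b c sel x z 0).count i = 0 := rfl

theorem count_succ (x : Fin N → ℕ → ℝ) (z : ℕ → Fin N → ℝ) (t : ℕ) (i : Fin N) :
    (stateAfter b c sel x z (t + 1)).count i =
      (stateAfter b c sel x z t).count i + if armAt b c sel x z t = i then 1 else 0 := by
  rw [stateAfter_succ]
  by_cases h : armAt b c sel x z t = i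
  · subst h; simp [State.pull]
  · simp [State.pull, h, Function.update_of_ne (Ne.symm h)]

theorem muHat_eq (x : Fin N → ℕ → ℝ) (z : ℕ → Fin N → ℝ) (t : ℕ) (i : Fin N) :
    (stateAfter b c sel x z t).muHat i =
      offsetMean (x i) ((stateAfter b c sel x z t).count i) := by
  induction t with
  | zero => simp [stateAfter, State.init, offsetMean]
  | succ t ih =>
    rw [count_succ, stateAfter_succ]
    by_cases h : armAt b c sel x z t = i
    · subst h
      simp only [State.pull, Function.update_self, if_true, ih]
      simp only [offsetMean, Finset.sum_range_succ, rewardAt]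
      push_cast
      set n := (stateAfter b c sel x z t).count (armAt b c sel x z t)
      have h1 : (n : ℝ) + 1 ≠ 0 := by positivity
      field_simp
      ring
    · simp [State.pull, h, Function.update_of_ne (Ne.symm h), ih]

theorem theta_stateAfter (x : Fin N → ℕ → ℝ) (z : ℕ → Fin N → ℝ) (t : ℕ) (w : Fin N → ℝ)
    (i : Fin N) :
    theta c (stateAfter b c sel x z t) w i =
      offsetMean (x i) ((stateAfter b c sel x z t).count i) +
        √(c / (((stateAfter b c sel x z t).count i : ℝ) + 1)) * w i := by
  rw [theta, muHat_eq]

theorem sum_count (x : Fin N → ℕ → ℝ) (z : ℕ → Fin N → ℝ) (t : ℕ) :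
    ∑ i, (stateAfter b c sel x z t).count i = t := by
  induction t with
  | zero => simp [count_zero]
  | succ t ih => simp [count_succ, Finset.sum_add_distrib, ih]

theorem count_le (x : Fin N → ℕ → ℝ) (z : ℕ → Fin N → ℝ) (t : ℕ) (i : Fin N) :
    (stateAfter b c sel x z t).count i ≤ t := by
  induction t with
  | zero => simp [count_zero]
  | succ t ih => rw [count_succ]; split_ifs <;> omega

theorem count_mono (x : Fin N → ℕ → ℝ) (z : ℕ → Fin N → ℝ) (i : Fin N) :
    Monotone fun t => (stateAfter b c sel x z t).count i :=
  monotone_nat_of_le_succ fun t => by rw [count_succ]; omega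

/-- Summing over the rounds in which arm `i` is played is summing over the pulls of arm `i`. -/
theorem sum_pulls {M : Type*} [AddCommMonoid M] (x : Fin N → ℕ → ℝ) (z : ℕ → Fin N → ℝ)
    (i : Fin N) (f : ℕ → M) (T : ℕ) :
    (∑ t ∈ Finset.range T,
      if armAt b c sel x z t = i then f ((stateAfter b c sel x z t).count i) else 0) =
      ∑ k ∈ Finset.range ((stateAfter b c sel x z T).count i), f k := by
  induction T with
  | zero => simp [count_zero]
  | succ T ih =>
    rw [Finset.sum_range_succ, ih, count_succ]
    split_ifs with h
    · rw [Finset.sum_range_succ]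
    · simp

theorem sum_reward (x : Fin N → ℕ → ℝ) (z : ℕ → Fin N → ℝ) (T : ℕ) :
    ∑ t ∈ Finset.range T, rewardAt b c sel x z t =
      ∑ i, ∑ k ∈ Finset.range T,
        if k < (stateAfter b c sel x z T).count i then x i k else 0 := by
  have h1 : ∀ i, (∑ k ∈ Finset.range T,
        if k < (stateAfter b c sel x z T).count i then x i k else 0) =
      ∑ k ∈ Finset.range ((stateAfter b c sel x z T).count i), x i k := by
    intro i
    rw [← Finset.sum_filter]
    congr 1
    ext k
    have := count_le b c sel x z T i
    simp
    omega
  simp_rw [h1, ← sum_pulls b c sel x z]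
  rw [Finset.sum_comm]
  simp [rewardAt]

/-- Arm `i` owns the rounds from `i * b` to `i * b + b - 1`; truncated subtraction gives the value
`0` before that block. -/
theorem count_prephase (x : Fin N → ℕ → ℝ) (z : ℕ → Fin N → ℝ) (i : Fin N) {t : ℕ}
    (ht : t ≤ b * N) :
    (stateAfter b c sel x z t).count i = min b (t - i * b) := by
  induction t with
  | zero => simp [count_zero]
  | succ t ih =>
    have h : t < b * N := ht
    have hb : 0 < b := Nat.pos_of_ne_zero fun h0 => by simp [h0] at h
    rw [count_succ, ih h.le]
    have harm : armAt b c sel x z t = i ↔ t / b = i := by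
      simp [armAt, choose, h, Fin.ext_iff]
    rw [if_congr harm rfl rfl]
    have h2 := Nat.div_add_mod t b
    have h3 := Nat.mod_lt t hb
    split_ifs with h4
    · rw [h4, mul_comm b] at h2
      omega
    · rcases lt_or_gt_of_ne h4 with h5 | h5
      · have : b * (t / b) + b ≤ i * b := by
          calc b * (t / b) + b = (t / b + 1) * b := by ring
            _ ≤ i * b := Nat.mul_le_mul_right _ h5
        omega
      · have : i * b + b ≤ b * (t / b) := by
          calc i * b + b = (i + 1) * b := by ring
            _ ≤ (t / b) * b := Nat.mul_le_mul_right _ h5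
            _ = _ := mul_comm _ _
        omega

theorem count_prephase_end (x : Fin N → ℕ → ℝ) (z : ℕ → Fin N → ℝ) (i : Fin N) :
    (stateAfter b c sel x z (b * N)).count i = b := by
  rw [count_prephase b c sel x z i le_rfl, min_eq_left]
  have : (i + 1) * b ≤ N * b := Nat.mul_le_mul_right _ i.2
  rw [mul_comm b N]
  have h : ((i : ℕ) + 1) * b = i * b + b := by ring
  omega

theorem count_eq_add_sum (x : Fin N → ℕ → ℝ) (z : ℕ → Fin N → ℝ) (i : Fin N) {T : ℕ}
    (hT : b * N ≤ T) :
    (stateAfter b c sel x z T).count i =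
      b + ∑ t ∈ Finset.Ico (b * N) T, if armAt b c sel x z t = i then 1 else 0 := by
  induction T, hT using Nat.le_induction with
  | base => simp [count_prephase_end]
  | succ T h ih => rw [count_succ, ih, Finset.sum_Ico_succ_top h, add_assoc]

theorem stateAfter_congr_noise (x : Fin N → ℕ → ℝ) {z z' : ℕ → Fin N → ℝ} {t : ℕ}
    (h : ∀ s < t, z s = z' s) : stateAfter b c sel x z t = stateAfter b c sel x z' t := by
  induction t with
  | zero => rfl
  | succ t ih =>
    simp only [stateAfter]
    rw [ih fun s hs => h s (by omega), h t (by omega)]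

/-- Whether arm `i` is pulled more than `k` times does not depend on the reward of its pull
number `k`. -/
theorem lt_count_congr_reward {x x' : Fin N → ℕ → ℝ} (z : ℕ → Fin N → ℝ) {i : Fin N} {k : ℕ}
    (h : ∀ j l, (j, l) ≠ (i, k) → x j l = x' j l) (T : ℕ) :
    k < (stateAfter b c sel x z T).count i ↔ k < (stateAfter b c sel x' z T).count i := by
  -- The two runs coincide until the altered reward is collected, and by then both counts have
  -- passed `k` for good. This dichotomy is what survives induction.
  have key : (stateAfter b c sel x z T = stateAfter b c sel x' z T ∧
      (stateAfter b c sel x z T).count i ≤ k) ∨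
      (k < (stateAfter b c sel x z T).count i ∧ k < (stateAfter b c sel x' z T).count i) := by
    induction T with
    | zero => exact Or.inl ⟨rfl, Nat.zero_le _⟩
    | succ T ih =>
      rcases ih with ⟨h1, h2⟩ | ⟨h1, h2⟩
      · have harm : armAt b c sel x z T = armAt b c sel x' z T := by simp [armAt, h1]
        by_cases hk : armAt b c sel x z T = i ∧ (stateAfter b c sel x z T).count i = k
        · right
          rw [count_succ, count_succ, ← harm, ← h1, if_pos hk.1]
          omega
        · left
          have hrew : rewardAt b c sel x z T = rewardAt b c sel x' z T := by
            rw [rewardAt, rewardAt, ← harm, ← h1]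
            apply h
            rintro h3
            simp only [Prod.mk.injEq] at h3
            exact hk ⟨h3.1, by rw [← h3.2, h3.1]⟩
          refine ⟨by rw [stateAfter_succ, stateAfter_succ, h1, harm, hrew], ?_⟩
          rw [count_succ]
          split_ifs with h3
          · have : (stateAfter b c sel x z T).count i ≠ k := fun h4 => hk ⟨h3, h4⟩
            omega
          · omega
      · right
        rw [count_succ, count_succ]
        omega
  rcases key with ⟨h1, h2⟩ | ⟨h1, h2⟩
  · rw [h1]
  · simp [h1, h2]

end Deterministic

end ModifiedTS

/-! ### Resampling one coordinate of a product measure. -/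

namespace MeasureTheory.Measure

/-- Resampling one coordinate does not change an infinite product measure. -/
theorem infinitePi_map_update {ι : Type*} [DecidableEq ι] {E : ι → Type*}
    [∀ i, MeasurableSpace (E i)] (μ : (i : ι) → Measure (E i)) [∀ i, IsProbabilityMeasure (μ i)]
    (i : ι) :
    ((infinitePi μ).prod (μ i)).map (fun p : ((j : ι) → E j) × E i => Function.update p.1 i p.2) =
      infinitePi μ := by
  have hm : Measurable fun p : ((j : ι) → E j) × E i => Function.update p.1 i p.2 :=
    measurable_update'
  refine eq_infinitePi μ fun s t ht => ?_
  rw [map_apply hm (MeasurableSet.pi s.countable_toSet fun j _ => ht j)]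
  by_cases hi : i ∈ s
  · have : (fun p : ((j : ι) → E j) × E i => Function.update p.1 i p.2) ⁻¹' (Set.pi s t) =
        (Set.pi (s.erase i : Finset ι) t) ×ˢ t i := by
      ext p
      simp only [Set.mem_preimage, Set.mem_pi, Finset.mem_coe, Set.mem_prod, Finset.mem_erase]
      constructor
      · intro h
        refine ⟨fun j hj => ?_, ?_⟩
        · simpa [Function.update_of_ne hj.1] using h j hj.2
        · simpa using h i hi
      · rintro ⟨h1, h2⟩ j hj
        by_cases h : j = i
        · subst h; simpa using h2
        · rw [Function.update_of_ne h]; exact h1 j ⟨h, hj⟩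
    rw [this, prod_prod, infinitePi_pi _ (fun j _ => ht j), mul_comm,
      Finset.mul_prod_erase s (fun j => μ j (t j)) hi]
  · have : (fun p : ((j : ι) → E j) × E i => Function.update p.1 i p.2) ⁻¹' (Set.pi s t) =
        (Set.pi s t) ×ˢ Set.univ := by
      ext p
      simp only [Set.mem_preimage, Set.mem_pi, Finset.mem_coe, Set.mem_prod, Set.mem_univ,
        and_true]
      refine forall₂_congr fun j hj => ?_
      rw [Function.update_of_ne (ne_of_mem_of_not_mem hj hi)]
    rw [this, prod_prod, infinitePi_pi _ (fun j _ => ht j), measure_univ, mul_one]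

/-- This is the form in which independence is used: one noise is integrated out with all other
variables held fixed. -/
theorem lintegral_infinitePi_update {ι : Type*} [DecidableEq ι] {E : ι → Type*}
    [∀ i, MeasurableSpace (E i)] (μ : (i : ι) → Measure (E i)) [∀ i, IsProbabilityMeasure (μ i)]
    (i : ι) {f : ((j : ι) → E j) → ENNReal} (hf : Measurable f) :
    ∫⁻ y, f y ∂infinitePi μ = ∫⁻ y, ∫⁻ u, f (Function.update y i u) ∂μ i ∂infinitePi μ := by
  have hm : Measurable fun p : ((j : ι) → E j) × E i => Function.update p.1 i p.2 :=
    measurable_update'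
  conv_lhs => rw [← infinitePi_map_update μ i]
  rw [lintegral_map hf hm]
  exact lintegral_prod _ (hf.comp hm).aemeasurable

end MeasureTheory.Measure

/-! ### The canonical sample space and measurability. -/

namespace ModifiedTS

/-- The index set of the primitive random variables: rewards and noises. -/
abbrev SampleIndex (N : ℕ) := (Fin N × ℕ) ⊕ (ℕ × Fin N)

abbrev rewards {N : ℕ} (y : SampleIndex N → ℝ) : Fin N → ℕ → ℝ := fun i k => y (Sum.inl (i, k))

abbrev noises {N : ℕ} (y : SampleIndex N → ℝ) : ℕ → Fin N → ℝ := fun t i => y (Sum.inr (t, i))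

/-- Needed because estimates are evaluated at a random pull count, which takes countably many
values. -/
theorem measurable_comp_countable {α β γ : Type*} [MeasurableSpace α] [MeasurableSpace β]
    [MeasurableSpace γ] [Countable β] [MeasurableSingletonClass β] {f : α → β → γ}
    {n : α → β} (hf : ∀ k, Measurable fun a => f a k) (hn : Measurable n) :
    Measurable fun a => f a (n a) := by
  have : Measurable fun p : α × β => f p.1 p.2 := measurable_from_prod_countable_left hf
  exact this.comp (measurable_id.prodMk hn)

section Measurability

variable {N b : ℕ} {c : ℝ} {sel : (Fin N → ℝ) → Fin N}

theorem measurable_offsetMean (i : Fin N) (k : ℕ) :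
    Measurable fun y : SampleIndex N → ℝ => offsetMean (rewards y i) k := by
  unfold offsetMean
  fun_prop

theorem measurable_armAt_of_count (hsel : Measurable sel) (t : ℕ)
    (h : ∀ i, Measurable fun y : SampleIndex N → ℝ =>
      (stateAfter b c sel (rewards y) (noises y) t).count i) :
    Measurable fun y : SampleIndex N → ℝ => armAt b c sel (rewards y) (noises y) t := by
  unfold armAt choose
  split_ifs with ht
  · exact measurable_const
  · refine hsel.comp (measurable_pi_iff.2 fun i => ?_)
    simp only [theta_stateAfter]
    exact measurable_comp_countable
      (f := fun (y : SampleIndex N → ℝ) (k : ℕ) =>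
        offsetMean (rewards y i) k + √(c / ((k : ℝ) + 1)) * noises y t i)
      (fun k => (measurable_offsetMean i k).add (by fun_prop)) (h i)

theorem measurable_count (hsel : Measurable sel) (t : ℕ) (i : Fin N) :
    Measurable fun y : SampleIndex N → ℝ =>
      (stateAfter b c sel (rewards y) (noises y) t).count i := by
  induction t generalizing i with
  | zero => simp only [count_zero]; exact measurable_const
  | succ t ih =>
    simp only [count_succ]
    refine (ih i).add (Measurable.ite ?_ measurable_const measurable_const)
    exact measurable_armAt_of_count hsel t ih (measurableSet_singleton i)

theorem measurable_armAt (hsel : Measurable sel) (t : ℕ) :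
    Measurable fun y : SampleIndex N → ℝ => armAt b c sel (rewards y) (noises y) t :=
  measurable_armAt_of_count hsel t (measurable_count hsel t)

theorem measurable_theta (hsel : Measurable sel) (t : ℕ) (i : Fin N) :
    Measurable fun y : SampleIndex N → ℝ =>
      theta c (stateAfter b c sel (rewards y) (noises y) t) (noises y t) i := by
  simp only [theta_stateAfter]
  exact measurable_comp_countable
      (f := fun (y : SampleIndex N → ℝ) (k : ℕ) =>
        offsetMean (rewards y i) k + √(c / ((k : ℝ) + 1)) * noises y t i)
      (fun k => (measurable_offsetMean i k).add (by fun_prop)) (measurable_count hsel t i)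

/-- The state after `t` rounds is not affected by the noises of round `t`. -/
theorem stateAfter_update_noise (b : ℕ) (c : ℝ) (sel : (Fin N → ℝ) → Fin N)
    (y : SampleIndex N → ℝ) (t : ℕ) (i : Fin N) (u : ℝ) :
    stateAfter b c sel (rewards (Function.update y (Sum.inr (t, i)) u))
        (noises (Function.update y (Sum.inr (t, i)) u)) t =
      stateAfter b c sel (rewards y) (noises y) t := by
  have h : rewards (Function.update y (Sum.inr (t, i)) u) = rewards y := by
    ext j k; simp [rewards]
  rw [h]
  refine stateAfter_congr_noise b c sel _ fun s hs => ?_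
  ext j
  have : (s, j) ≠ (t, i) := fun h => hs.ne (congrArg Prod.fst h)
  simp [noises, this]

end Measurability

end ModifiedTS

/-! ### Gaussian tails, odds and exponential moments. -/

namespace ModifiedTS

/-- The upper tail of the standard Gaussian law. -/
noncomputable def gaussTail (a : ℝ) : ℝ := (gaussianReal 0 1).real (Set.Ioi a)

theorem gaussTail_antitone : Antitone gaussTail := fun _ _ h =>
  measureReal_mono (Set.Ioi_subset_Ioi h)

theorem gaussTail_le_one (a : ℝ) : gaussTail a ≤ 1 := measureReal_le_one

theorem hasSubgaussianMGF_id_gaussianReal : HasSubgaussianMGF id 1 (gaussianReal 0 1) where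
  integrable_exp_mul t := integrable_exp_mul_gaussianReal t
  mgf_le t := by rw [mgf_id_gaussianReal]; simp

theorem gaussTail_le_exp {a : ℝ} (ha : 0 ≤ a) : gaussTail a ≤ Real.exp (-(a ^ 2 / 2)) := by
  refine (measureReal_mono (fun x (hx : a < x) => hx.le)).trans
    ((hasSubgaussianMGF_id_gaussianReal.measure_ge_le ha).trans (le_of_eq ?_))
  simp [neg_div]

theorem one_sub_gaussTail (a : ℝ) : 1 - gaussTail a = (gaussianReal 0 1).real (Set.Iic a) := by
  rw [gaussTail, ← Set.compl_Iic, probReal_compl_eq_one_sub measurableSet_Iic, sub_sub_cancel]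

theorem one_sub_gaussTail_le_exp {a : ℝ} (ha : a ≤ 0) :
    1 - gaussTail a ≤ Real.exp (-(a ^ 2 / 2)) := by
  rw [one_sub_gaussTail]
  refine (measureReal_mono (s₂ := {x | -a ≤ (-id) x}) (fun x (hx : x ≤ a) => ?_)).trans
    ((hasSubgaussianMGF_id_gaussianReal.neg.measure_ge_le (neg_nonneg.2 ha)).trans (le_of_eq ?_))
  · simpa using hx
  · simp [neg_div]

theorem half_le_gaussTail {a : ℝ} (ha : a ≤ 0) : 1 / 2 ≤ gaussTail a := by
  refine le_trans ?_ (gaussTail_antitone ha)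
  have h1 := one_sub_gaussTail 0
  have h2 : (gaussianReal 0 1).real (Set.Iic 0) = gaussTail 0 := by
    have h := gaussianReal_map_neg (μ := 0) (v := 1)
    rw [neg_zero] at h
    have := nullSingletonClass_gaussianReal (μ := 0) (v := 1) one_ne_zero
    rw [gaussTail, measureReal_def, measureReal_def, measure_congr (Ioi_ae_eq_Ici (a := (0 : ℝ)))]
    conv_rhs => rw [← h, Measure.map_apply measurable_neg measurableSet_Ici]
    simp
  linarith

/-- For `a ≥ 0` the density on `(a, a + 1]` is at least its value at the right end. This crude bound
loses only a shift by one, which the later moment bounds absorb. -/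
theorem inv_sqrt_mul_exp_le_gaussTail (a : ℝ) :
    (√(2 * Real.pi))⁻¹ * Real.exp (-((a + 1) ^ 2 / 2)) ≤ gaussTail a := by
  have hpi : 2 ≤ √(2 * Real.pi) := Real.le_sqrt_of_sq_le (by nlinarith [Real.pi_gt_three])
  rcases le_total a 0 with ha | ha
  · refine le_trans ?_ (half_le_gaussTail ha)
    have h1 : (√(2 * Real.pi))⁻¹ ≤ 1 / 2 := by
      rw [one_div]; exact inv_anti₀ (by norm_num) hpi
    have h2 : Real.exp (-((a + 1) ^ 2 / 2)) ≤ 1 := Real.exp_le_one_iff.2 (by nlinarith [sq_nonneg (a+1)])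
    calc _ ≤ (1 / 2 : ℝ) * 1 := mul_le_mul h1 h2 (Real.exp_pos _).le (by norm_num)
      _ = _ := mul_one _
  · have hsub : Set.Ioc a (a + 1) ⊆ Set.Ioi a := fun x hx => hx.1
    refine le_trans ?_ (measureReal_mono hsub)
    rw [measureReal_def, gaussianReal_apply_eq_integral _ one_ne_zero, ENNReal.toReal_ofReal
      (setIntegral_nonneg measurableSet_Ioc fun x _ => gaussianPDFReal_nonneg _ _ _)]
    have h : ∫ x in Set.Ioc a (a + 1), (√(2 * Real.pi))⁻¹ * Real.exp (-((a + 1) ^ 2 / 2)) ≤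
        ∫ x in Set.Ioc a (a + 1), gaussianPDFReal 0 1 x := by
      refine setIntegral_mono_on (integrableOn_const (by simp)) (integrable_gaussianPDFReal 0 1).integrableOn
        measurableSet_Ioc fun x hx => ?_
      rw [gaussianPDFReal_def]
      simp only [NNReal.coe_one, mul_one, sub_zero]
      gcongr
      rw [neg_div, neg_le_neg_iff]
      have : x ^ 2 ≤ (a + 1) ^ 2 := pow_le_pow_left₀ (ha.trans hx.1.le) hx.2 2
      linarith
    simpa using h

theorem gaussTail_pos (a : ℝ) : 0 < gaussTail a :=
  lt_of_lt_of_le (by positivity) (inv_sqrt_mul_exp_le_gaussTail a)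

/-- The odds that a standard Gaussian variable does not exceed `a`. -/
noncomputable def gaussOdds (a : ℝ) : ℝ := (1 - gaussTail a) / gaussTail a

theorem gaussOdds_nonneg (a : ℝ) : 0 ≤ gaussOdds a :=
  div_nonneg (sub_nonneg.2 (gaussTail_le_one a)) (gaussTail_pos a).le

theorem gaussOdds_mono : Monotone gaussOdds := fun _ _ h =>
  div_le_div₀ (sub_nonneg.2 (gaussTail_le_one _)) (sub_le_sub_left (gaussTail_antitone h) 1)
    (gaussTail_pos _) (gaussTail_antitone h)

theorem gaussOdds_le (a : ℝ) :
    gaussOdds a ≤ √(2 * Real.pi) * Real.exp ((a + 1) ^ 2 / 2) := by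
  rw [gaussOdds, div_le_iff₀ (gaussTail_pos a)]
  have h := inv_sqrt_mul_exp_le_gaussTail a
  have h2 : 0 < √(2 * Real.pi) := by positivity
  calc 1 - gaussTail a ≤ 1 := by linarith [gaussTail_pos a]
    _ = √(2 * Real.pi) * Real.exp ((a + 1) ^ 2 / 2) *
        ((√(2 * Real.pi))⁻¹ * Real.exp (-((a + 1) ^ 2 / 2))) := by
      rw [Real.exp_neg]; field_simp
    _ ≤ _ := by gcongr

theorem gaussOdds_le_of_nonpos {a : ℝ} (ha : a ≤ 0) :
    gaussOdds a ≤ 2 * Real.exp (-(a ^ 2 / 2)) := by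
  rw [gaussOdds, div_le_iff₀ (gaussTail_pos a)]
  have h1 := half_le_gaussTail ha
  have h2 := one_sub_gaussTail_le_exp ha
  nlinarith [Real.exp_pos (-(a ^ 2 / 2))]

theorem lintegral_exp_mul_gaussianReal (v : ℝ) :
    ∫⁻ ξ, ENNReal.ofReal (Real.exp (v * ξ)) ∂gaussianReal 0 1 =
      ENNReal.ofReal (Real.exp (v ^ 2 / 2)) := by
  rw [← ofReal_integral_eq_lintegral_ofReal (integrable_exp_mul_gaussianReal v)
    (ae_of_all _ fun _ => (Real.exp_pos _).le)]
  have := congrFun (mgf_id_gaussianReal (μ := 0) (v := 1)) v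
  simp only [mgf, id_eq] at this
  rw [this]
  simp

/-- Completing the square turns the integrand into a multiple of the Gaussian density with mean
`4τ/3` and variance `4/3`. -/
theorem lintegral_exp_quadratic_gaussianReal (τ : ℝ) :
    ∫⁻ ξ, ENNReal.ofReal (Real.exp (ξ ^ 2 / 8 + τ * ξ)) ∂gaussianReal 0 1 =
      ENNReal.ofReal (√(4 / 3) * Real.exp (2 / 3 * τ ^ 2)) := by
  rw [gaussianReal_of_var_ne_zero _ one_ne_zero,
    lintegral_withDensity_eq_lintegral_mul _ (measurable_gaussianPDF 0 1) (by fun_prop)]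
  have h : ∀ ξ : ℝ, (gaussianPDF 0 1 * fun ξ => ENNReal.ofReal (Real.exp (ξ ^ 2 / 8 + τ * ξ))) ξ =
      ENNReal.ofReal (√(4 / 3) * Real.exp (2 / 3 * τ ^ 2)) *
        gaussianPDF (4 / 3 * τ) (4 / 3) ξ := by
    intro ξ
    simp only [Pi.mul_apply, gaussianPDF_def]
    rw [← ENNReal.ofReal_mul (gaussianPDFReal_nonneg _ _ _), ← ENNReal.ofReal_mul (by positivity)]
    congr 1
    simp only [gaussianPDFReal_def]
    have h43 : (((4 / 3 : NNReal)) : ℝ) = 4 / 3 := by norm_num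
    rw [h43, NNReal.coe_one, mul_one, sub_zero, Real.sqrt_mul' _ (by norm_num : (0:ℝ) ≤ 4/3),
      mul_assoc, ← Real.exp_add, mul_inv]
    have : √(4 / 3 : ℝ) ≠ 0 := by positivity
    calc _ = (√(2 * Real.pi))⁻¹ *
          (Real.exp (2 / 3 * τ ^ 2) * Real.exp (-(ξ - 4 / 3 * τ) ^ 2 / (2 * (4 / 3)))) := by
          rw [← Real.exp_add]; ring_nf
      _ = _ := by field_simp
  simp_rw [h]
  rw [lintegral_const_mul _ (measurable_gaussianPDF _ _), lintegral_gaussianPDF_eq_one _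
    (by norm_num), mul_one]

/-- The exponential of a quadratic function of a sub-Gaussian variable of variance proxy `1 / 4`. -/
theorem lintegral_exp_sq_le {Ω : Type*} [MeasurableSpace Ω] {P : Measure Ω}
    [IsProbabilityMeasure P] {V : Ω → ℝ} (hV : Measurable V) (h : HasSubgaussianMGF V (1 / 4) P)
    (κ l s : ℝ) :
    ∫⁻ ω, ENNReal.ofReal (Real.exp ((V ω + κ) ^ 2 / 2 + l * (V ω - s))) ∂P ≤
      ENNReal.ofReal (√(4 / 3) *
        Real.exp (2 / 3 * (κ + l / 4) ^ 2 + l ^ 2 / 8 - l * s)) := by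
  -- An auxiliary standard Gaussian `ξ` linearizes the square, so after Tonelli only the moment
  -- generating function of `V` is needed.
  have h1 : ∀ ω, ENNReal.ofReal (Real.exp ((V ω + κ) ^ 2 / 2 + l * (V ω - s))) =
      ∫⁻ ξ, ENNReal.ofReal (Real.exp ((V ω + κ) * ξ + l * (V ω - s))) ∂gaussianReal 0 1 := by
    intro ω
    simp_rw [Real.exp_add, ENNReal.ofReal_mul (Real.exp_pos _).le]
    rw [lintegral_mul_const _ (by fun_prop), lintegral_exp_mul_gaussianReal]
  simp_rw [h1]
  rw [lintegral_lintegral_swap (by fun_prop)]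
  calc _ ≤ ∫⁻ ξ, ENNReal.ofReal (Real.exp (l ^ 2 / 8 - l * s)) *
        ENNReal.ofReal (Real.exp (ξ ^ 2 / 8 + (κ + l / 4) * ξ)) ∂gaussianReal 0 1 := by
        refine lintegral_mono fun ξ => ?_
        have h2 : ∀ ω, ENNReal.ofReal (Real.exp ((V ω + κ) * ξ + l * (V ω - s))) =
            ENNReal.ofReal (Real.exp (κ * ξ - l * s)) *
              ENNReal.ofReal (Real.exp ((ξ + l) * V ω)) := by
          intro ω
          rw [← ENNReal.ofReal_mul (Real.exp_pos _).le, ← Real.exp_add]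
          ring_nf
        simp_rw [h2]
        rw [lintegral_const_mul _ (by fun_prop),
          ← ofReal_integral_eq_lintegral_ofReal (h.integrable_exp_mul _)
            (ae_of_all _ fun _ => (Real.exp_pos _).le),
          ← ENNReal.ofReal_mul (Real.exp_pos _).le, ← ENNReal.ofReal_mul (Real.exp_pos _).le]
        refine ENNReal.ofReal_le_ofReal ?_
        have h3 := h.mgf_le (ξ + l)
        rw [mgf] at h3
        calc _ ≤ Real.exp (κ * ξ - l * s) * Real.exp (((1 / 4 : NNReal) : ℝ) * (ξ + l) ^ 2 / 2) := by
              gcongr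
          _ = _ := by
              rw [← Real.exp_add, ← Real.exp_add]
              congr 1
              push_cast
              ring
    _ = _ := by
        rw [lintegral_const_mul _ (by fun_prop), lintegral_exp_quadratic_gaussianReal,
          ← ENNReal.ofReal_mul (Real.exp_pos _).le, mul_left_comm, ← Real.exp_add]
        ring_nf

end ModifiedTS

/-! ### Concentration of the rewards and the expected odds of an arm. -/

namespace ModifiedTS

theorem sum_exp_neg_succ_mul_le {α : ℝ} (hα : 0 < α) (n : ℕ) :
    ∑ k ∈ Finset.range n, Real.exp (-(((k : ℝ) + 1) * α)) ≤ 1 / α := by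
  -- The strengthened bound telescopes, because `α ≤ exp α - 1`.
  suffices h : ∑ k ∈ Finset.range n, Real.exp (-(((k : ℝ) + 1) * α)) ≤
      (1 - Real.exp (-(n * α))) / α by
    refine h.trans ?_
    gcongr
    linarith [Real.exp_pos (-(n * α))]
  induction n with
  | zero => simp
  | succ n ih =>
    rw [Finset.sum_range_succ]
    refine (add_le_add_left ih _).trans ?_
    rw [← sub_nonneg]
    have h1 : Real.exp (-(n * α)) = Real.exp (-(((n : ℝ) + 1) * α)) * Real.exp α := by
      rw [← Real.exp_add]; ring_nf
    have h2 : (1 - Real.exp (-(((n + 1 : ℕ) : ℝ) * α))) / α -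
        ((1 - Real.exp (-(n * α))) / α + Real.exp (-(((n : ℝ) + 1) * α))) =
        Real.exp (-(((n : ℝ) + 1) * α)) * (Real.exp α - 1 - α) / α := by
      rw [h1]; push_cast; field_simp; ring
    rw [h2]
    have := Real.add_one_le_exp α
    have h3 : 0 ≤ Real.exp α - 1 - α := by linarith
    positivity

/-- The laws of the primitive random variables. -/
noncomputable def sampleLaw {N : ℕ} (D : Fin N → Measure ℝ) : SampleIndex N → Measure ℝ :=
  Sum.elim (fun p => D p.1) (fun _ => gaussianReal 0 1)

instance {N : ℕ} (D : Fin N → Measure ℝ) [∀ i, IsProbabilityMeasure (D i)] (p : SampleIndex N) :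
    IsProbabilityMeasure (sampleLaw D p) := by
  rcases p with p | p <;> simp only [sampleLaw, Sum.elim_inl, Sum.elim_inr] <;> infer_instance

/-- The joint law of the primitive random variables. -/
noncomputable abbrev jointLaw {N : ℕ} (D : Fin N → Measure ℝ) [∀ i, IsProbabilityMeasure (D i)] :
    Measure (SampleIndex N → ℝ) :=
  Measure.infinitePi (sampleLaw D)

section Concentration

variable {N : ℕ} {D : Fin N → Measure ℝ} [∀ i, IsProbabilityMeasure (D i)]

theorem armMean_mem_Icc {i : Fin N} (hD : ∀ᵐ y ∂(D i), y ∈ Set.Icc (0 : ℝ) 1) :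
    armMean D i ∈ Set.Icc (0 : ℝ) 1 := by
  have hint : Integrable (fun y : ℝ => y) (D i) :=
    Integrable.of_mem_Icc 0 1 aemeasurable_id hD
  refine ⟨integral_nonneg_of_ae (hD.mono fun y hy => hy.1), ?_⟩
  have := integral_mono_ae hint (integrable_const (1 : ℝ)) (hD.mono fun y hy => hy.2)
  simpa [armMean] using this

theorem map_reward_jointLaw (i : Fin N) (k : ℕ) :
    (jointLaw D).map (fun y => rewards y i k) = D i :=
  Measure.infinitePi_map_eval (sampleLaw D) (Sum.inl (i, k))

theorem integral_reward (i : Fin N) (k : ℕ) :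
    ∫ y, rewards y i k ∂jointLaw D = armMean D i := by
  rw [armMean, ← map_reward_jointLaw (D := D) i k, integral_map (measurable_pi_apply _).aemeasurable (by fun_prop)]

theorem hasSubgaussianMGF_reward {i : Fin N} (hD : ∀ᵐ y ∂(D i), y ∈ Set.Icc (0 : ℝ) 1) (k : ℕ) :
    HasSubgaussianMGF (fun y => rewards y i k - armMean D i) (1 / 4) (jointLaw D) := by
  rw [← map_reward_jointLaw (D := D) i k] at hD
  have h := hasSubgaussianMGF_of_mem_Icc (μ := jointLaw D) (X := fun y => rewards y i k)
    (measurable_pi_apply _).aemeasurable (ae_of_ae_map (measurable_pi_apply _).aemeasurable hD)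
  rw [integral_reward] at h
  convert h using 1
  norm_num

theorem iIndepFun_reward (i : Fin N) :
    iIndepFun (fun k (y : SampleIndex N → ℝ) => rewards y i k - armMean D i) (jointLaw D) := by
  have h : iIndepFun (fun p (y : SampleIndex N → ℝ) => y p - armMean D i) (jointLaw D) :=
    iIndepFun_infinitePi (P := sampleLaw D) (X := fun _ u => u - armMean D i) (by fun_prop)
  exact h.precomp (g := fun k : ℕ => (Sum.inl (i, k) : SampleIndex N)) fun k l h => by simpa using h

/-- Enlarging the variance proxy allows the single value `1/4` to serve for all `c` and all pull
counts. -/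
theorem hasSubgaussianMGF_mul_of_sq_mul_le {Ω : Type*} [MeasurableSpace Ω] {P : Measure Ω}
    {V : Ω → ℝ} {v w : NNReal} (h : HasSubgaussianMGF V v P) {r : ℝ} (hr : r ^ 2 * v ≤ w) :
    HasSubgaussianMGF (fun ω => r * V ω) w P where
  integrable_exp_mul := (h.const_mul r).integrable_exp_mul
  mgf_le t := by
    refine ((h.const_mul r).mgf_le t).trans (Real.exp_le_exp.2 ?_)
    change r ^ 2 * (v : ℝ) * t ^ 2 / 2 ≤ _
    gcongr

theorem hasSubgaussianMGF_sum_reward {i : Fin N} (hD : ∀ᵐ y ∂(D i), y ∈ Set.Icc (0 : ℝ) 1)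
    (k : ℕ) {r : ℝ} (hr : r ^ 2 * k ≤ 1) :
    HasSubgaussianMGF (fun y => r * ∑ l ∈ Finset.range k, (rewards y i l - armMean D i))
      (1 / 4) (jointLaw D) := by
  have h := HasSubgaussianMGF.sum_of_iIndepFun (iIndepFun_reward (D := D) i)
    (s := Finset.range k) fun l _ => hasSubgaussianMGF_reward hD l
  refine hasSubgaussianMGF_mul_of_sq_mul_le h ?_
  simp
  linarith

theorem measureReal_lt_offsetMean_le {i : Fin N} (hD : ∀ᵐ y ∂(D i), y ∈ Set.Icc (0 : ℝ) 1)
    (k : ℕ) {ε : ℝ} (hε : 0 ≤ ε) :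
    (jointLaw D).real {y | armMean D i + ε < offsetMean (rewards y i) k} ≤
      Real.exp (-(k * (2 * ε ^ 2))) := by
  have h := HasSubgaussianMGF.measure_sum_range_ge_le_of_iIndepFun (iIndepFun_reward (D := D) i) (n := k)
    (fun l _ => hasSubgaussianMGF_reward hD l) (ε := k * ε) (by positivity)
  have hμ := (armMean_mem_Icc hD).1
  refine (measureReal_mono fun y hy => ?_).trans (h.trans (Real.exp_le_exp.2 ?_))
  · simp only [Set.mem_ofPred_eq, offsetMean] at hy ⊢
    rw [lt_div_iff₀ (by positivity)] at hy
    simp only [Finset.sum_sub_distrib, Finset.sum_const, Finset.card_range, nsmul_eq_mul]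
    -- The offset in the denominator shrinks the estimate towards `0`; since the mean is
    -- nonnegative, this only helps the upper deviation.
    nlinarith
  · rcases Nat.eq_zero_or_pos k with rfl | hk
    · simp
    · have : (0 : ℝ) < k := by exact_mod_cast hk
      refine le_of_eq ?_
      push_cast
      field_simp
      ring

/-- The odds, given the first `j` rewards of arm `i`, that a posterior sample of that arm with
count `j` does not exceed `v`. -/
noncomputable def armOdds (c v : ℝ) (x : ℕ → ℝ) (j : ℕ) : ℝ :=
  gaussOdds ((v - offsetMean x j) * √(((j : ℝ) + 1) / c))

theorem sqrt_constant_le : √(2 * Real.pi) * √(4 / 3) ≤ 2.9 := by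
  rw [← Real.sqrt_mul' _ (by norm_num)]
  exact Real.sqrt_le_iff.2 ⟨by norm_num, by nlinarith [Real.pi_lt_d2]⟩

/-- The standardized lower deviation of the rewards of arm `i`. -/
noncomputable def lowerDev (c m : ℝ) (x : ℕ → ℝ) (j : ℕ) : ℝ :=
  -(√(c * ((j : ℝ) + 1)))⁻¹ * ∑ l ∈ Finset.range j, (x l - m)

/-- The argument splits into a centred fluctuation, the bias of the prior towards `0`, and the
margin gained from `Δ / 3`. -/
theorem armOdds_arg {c : ℝ} (hc : 1 ≤ c) (m Δ : ℝ) (x : ℕ → ℝ) (j : ℕ) :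
    (m - Δ / 3 - offsetMean x j) * √(((j : ℝ) + 1) / c) =
      lowerDev c m x j + m * (√(c * ((j : ℝ) + 1)))⁻¹ -
        Δ * (((j : ℝ) + 1) * (√(c * ((j : ℝ) + 1)))⁻¹) / 3 := by
  have hc0 : 0 < c := by linarith
  have hj : (0 : ℝ) < (j : ℝ) + 1 := by positivity
  have h1 : √(((j : ℝ) + 1) / c) = ((j : ℝ) + 1) * (√(c * ((j : ℝ) + 1)))⁻¹ := by
    rw [Real.sqrt_eq_iff_mul_self_eq (by positivity) (by positivity)]
    have := Real.mul_self_sqrt (show 0 ≤ c * ((j : ℝ) + 1) by positivity)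
    have h3 : √(c * ((j : ℝ) + 1)) ≠ 0 := by positivity
    rw [mul_mul_mul_comm, ← mul_inv, this]
    field_simp
  rw [h1, lowerDev, offsetMean]
  simp only [Finset.sum_sub_distrib, Finset.sum_const, Finset.card_range, nsmul_eq_mul]
  field_simp
  ring

theorem measurable_lowerDev (c m : ℝ) (i : Fin N) (j : ℕ) :
    Measurable fun y : SampleIndex N → ℝ => lowerDev c m (rewards y i) j := by
  unfold lowerDev; fun_prop

theorem hasSubgaussianMGF_lowerDev {c : ℝ} (hc : 1 ≤ c) {i : Fin N}
    (hD : ∀ᵐ y ∂(D i), y ∈ Set.Icc (0 : ℝ) 1) (j : ℕ) :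
    HasSubgaussianMGF (fun y => lowerDev c (armMean D i) (rewards y i) j) (1 / 4)
      (jointLaw D) := by
  refine hasSubgaussianMGF_sum_reward hD j ?_
  have hj : (0 : ℝ) ≤ j := by positivity
  rw [neg_sq, inv_pow, Real.sq_sqrt (by positivity), inv_mul_le_one₀ (by positivity)]
  nlinarith

theorem inv_sqrt_le_one {c : ℝ} (hc : 1 ≤ c) (j : ℕ) : (√(c * ((j : ℝ) + 1)))⁻¹ ≤ 1 := by
  have hj : (0 : ℝ) ≤ j := by positivity
  exact inv_le_one_of_one_le₀ (Real.one_le_sqrt.2 (by nlinarith))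

theorem lintegral_armOdds_le {c : ℝ} (hc : 1 ≤ c) {i : Fin N}
    (hD : ∀ᵐ y ∂(D i), y ∈ Set.Icc (0 : ℝ) 1) {Δ : ℝ} (hΔ : 0 ≤ Δ) (j : ℕ) :
    ∫⁻ y, ENNReal.ofReal (armOdds c (armMean D i - Δ / 3) (rewards y i) j) ∂jointLaw D ≤
      ENNReal.ofReal 60 := by
  have hμ := armMean_mem_Icc hD
  have hr := inv_sqrt_le_one hc j
  have hr0 : 0 ≤ (√(c * ((j : ℝ) + 1)))⁻¹ := by positivity
  calc _ ≤ ∫⁻ y, ENNReal.ofReal √(2 * Real.pi) * ENNReal.ofReal (Real.exp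
        ((lowerDev c (armMean D i) (rewards y i) j + 2) ^ 2 / 2 +
          0 * (lowerDev c (armMean D i) (rewards y i) j - 0))) ∂jointLaw D := by
        refine lintegral_mono fun y => ?_
        rw [← ENNReal.ofReal_mul (by positivity)]
        -- The bias is at most `1` and the margin is dropped; with the shift by one from
        -- `gaussOdds_le` this gives the `2` in the square.
        refine ENNReal.ofReal_le_ofReal ?_
        rw [armOdds, armOdds_arg hc]
        refine (gaussOdds_mono (b := lowerDev c (armMean D i) (rewards y i) j + 1) ?_).trans
          ((gaussOdds_le _).trans (le_of_eq (by ring_nf)))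
        have h1 : armMean D i * (√(c * ((j : ℝ) + 1)))⁻¹ ≤ 1 := mul_le_one₀ hμ.2 hr0 hr
        have h2 : 0 ≤ Δ * (((j : ℝ) + 1) * (√(c * ((j : ℝ) + 1)))⁻¹) / 3 := by positivity
        linarith
    _ ≤ ENNReal.ofReal √(2 * Real.pi) * ENNReal.ofReal (√(4 / 3) *
        Real.exp (2 / 3 * (2 + 0 / 4) ^ 2 + 0 ^ 2 / 8 - 0 * 0)) := by
        have := measurable_lowerDev c (armMean D i) i j
        rw [lintegral_const_mul _ (by fun_prop)]
        gcongr
        exact lintegral_exp_sq_le this (hasSubgaussianMGF_lowerDev hc hD j) 2 0 0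
    _ ≤ _ := by
        rw [← ENNReal.ofReal_mul (by positivity), ← mul_assoc]
        refine ENNReal.ofReal_le_ofReal ?_
        have h1 : Real.exp (2 / 3 * (2 + 0 / 4) ^ 2 + 0 ^ 2 / 8 - 0 * 0) ≤ 20.1 := by
          have h2 : Real.exp 3 = Real.exp 1 ^ 3 := by rw [← Real.exp_nat_mul]; norm_num
          have h3 : Real.exp 1 ^ 3 ≤ 2.7182818286 ^ 3 :=
            pow_le_pow_left₀ (Real.exp_pos 1).le Real.exp_one_lt_d9.le 3
          refine (Real.exp_le_exp.2 (by norm_num : _ ≤ (3 : ℝ))).trans ?_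
          rw [h2]
          exact h3.trans (by norm_num)
        calc _ ≤ (2.9 : ℝ) * 20.1 := mul_le_mul sqrt_constant_le h1 (by positivity) (by norm_num)
          _ ≤ 60 := by norm_num

theorem lintegral_armOdds_le_exp {c : ℝ} (hc : 1 ≤ c) {i : Fin N}
    (hD : ∀ᵐ y ∂(D i), y ∈ Set.Icc (0 : ℝ) 1) {Δ : ℝ} (hΔ : 0 < Δ) (hΔ1 : Δ ≤ 1) {j : ℕ}
    (hj : 18 * c ≤ ((j : ℝ) + 1) * Δ ^ 2) :
    ∫⁻ y, ENNReal.ofReal (armOdds c (armMean D i - Δ / 3) (rewards y i) j) ∂jointLaw D ≤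
      ENNReal.ofReal (2 * Real.exp (-(((j : ℝ) + 1) * (Δ ^ 2 / (162 * c)))) +
        8 * Real.exp (-(((j : ℝ) + 1) * (Δ ^ 2 / (36 * c))))) := by
  have hμ := armMean_mem_Icc hD
  have hc0 : 0 < c := by linarith
  set r := (√(c * ((j : ℝ) + 1)))⁻¹ with hr_def
  have hr0 : 0 ≤ r := by positivity
  set δ := Δ * (((j : ℝ) + 1) * r) / 3 with hδ_def
  have hδ0 : 0 ≤ δ := by positivity
  have hr2 : r ^ 2 = (c * ((j : ℝ) + 1))⁻¹ := by
    rw [hr_def, inv_pow, Real.sq_sqrt (by positivity)]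
  have hδ2 : δ ^ 2 = ((j : ℝ) + 1) * Δ ^ 2 / (9 * c) := by
    rw [hδ_def, div_pow, mul_pow, mul_pow, hr2]
    field_simp
    norm_num
  -- The threshold `18 * c` is chosen here: it keeps the prior bias within a sixth of the margin
  -- `δ`.
  have hrδ : r ≤ δ / 6 := by
    have : 18 ≤ ((j : ℝ) + 1) * Δ := by
      have : ((j : ℝ) + 1) * Δ ^ 2 ≤ ((j : ℝ) + 1) * Δ := by
        gcongr
        nlinarith
      linarith
    have h2 : 18 * r ≤ ((j : ℝ) + 1) * Δ * r := by gcongr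
    rw [hδ_def]
    nlinarith
  have hmr : armMean D i * r ≤ δ / 6 := (mul_le_of_le_one_left hr0 hμ.2).trans hrδ
  calc _ ≤ ∫⁻ y, (ENNReal.ofReal (2 * Real.exp (-(δ ^ 2 / 18))) +
        ENNReal.ofReal √(2 * Real.pi) * ENNReal.ofReal (Real.exp
        ((lowerDev c (armMean D i) (rewards y i) j + 1) ^ 2 / 2 +
          δ * (lowerDev c (armMean D i) (rewards y i) j - δ / 2)))) ∂jointLaw D := by
        refine lintegral_mono fun y => ?_
        rw [← ENNReal.ofReal_mul (by positivity), ← ENNReal.ofReal_add (by positivity)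
          (by positivity)]
        refine ENNReal.ofReal_le_ofReal ?_
        rw [armOdds, armOdds_arg hc]
        set V := lowerDev c (armMean D i) (rewards y i) j
        -- Below `δ / 2` the argument is at most `δ/2 + δ/6 - δ = -δ/3`. Above it, a Chernoff factor
        -- with slope `δ` pays for the growth of the odds.
        rcases le_total V (δ / 2) with hV | hV
        · refine le_trans ?_ (le_add_of_nonneg_right (by positivity))
          refine (gaussOdds_mono (b := -(δ / 3)) (by linarith)).trans
            ((gaussOdds_le_of_nonpos (by linarith)).trans (le_of_eq (by ring_nf)))
        · refine le_trans ?_ (le_add_of_nonneg_left (by positivity))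
          refine (gaussOdds_mono (b := V) (by linarith)).trans ((gaussOdds_le _).trans ?_)
          gcongr
          exact le_add_of_nonneg_right (mul_nonneg hδ0 (by linarith))
    _ ≤ ENNReal.ofReal (2 * Real.exp (-(δ ^ 2 / 18))) +
        ENNReal.ofReal √(2 * Real.pi) * ENNReal.ofReal (√(4 / 3) *
          Real.exp (2 / 3 * (1 + δ / 4) ^ 2 + δ ^ 2 / 8 - δ * (δ / 2))) := by
        have := measurable_lowerDev c (armMean D i) i j
        rw [lintegral_add_left measurable_const, lintegral_const, measure_univ, mul_one,
          lintegral_const_mul _ (by fun_prop)]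
        gcongr
        exact lintegral_exp_sq_le this (hasSubgaussianMGF_lowerDev hc hD j) 1 δ (δ / 2)
    _ ≤ _ := by
        rw [← ENNReal.ofReal_mul (by positivity), ← ENNReal.ofReal_add (by positivity)
          (by positivity), ← mul_assoc]
        refine ENNReal.ofReal_le_ofReal ?_
        have e1 : δ ^ 2 / 18 = ((j : ℝ) + 1) * (Δ ^ 2 / (162 * c)) := by
          rw [hδ2]; field_simp; norm_num
        have e2 : δ ^ 2 / 4 = ((j : ℝ) + 1) * (Δ ^ 2 / (36 * c)) := by
          rw [hδ2]; field_simp; norm_num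
        rw [← e1, ← e2]
        have h1 : Real.exp (2 / 3 * (1 + δ / 4) ^ 2 + δ ^ 2 / 8 - δ * (δ / 2)) ≤
            2.7182818286 * Real.exp (-(δ ^ 2 / 4)) := by
          refine (Real.exp_le_exp.2 (?_ : _ ≤ 1 + -(δ ^ 2 / 4))).trans ?_
          -- The exponent equals `2/3 + δ/3 - δ²/3`, and `1 - δ²/4` exceeds it by `(δ - 2)²/12`.
          · nlinarith [sq_nonneg (δ - 2)]
          · rw [Real.exp_add]
            gcongr
            exact Real.exp_one_lt_d9.le
        have h2 := mul_le_mul sqrt_constant_le h1 (Real.exp_pos _).le (by norm_num)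
        nlinarith [Real.exp_pos (-(δ ^ 2 / 4))]

theorem sum_lintegral_armOdds_le {c : ℝ} (hc : 1 ≤ c) {i : Fin N}
    (hD : ∀ᵐ y ∂(D i), y ∈ Set.Icc (0 : ℝ) 1) {Δ : ℝ} (hΔ : 0 < Δ) (hΔ1 : Δ ≤ 1) (T : ℕ) :
    ∑ j ∈ Finset.range T,
      ∫⁻ y, ENNReal.ofReal (armOdds c (armMean D i - Δ / 3) (rewards y i) j) ∂jointLaw D ≤
      ENNReal.ofReal (1692 * c / Δ ^ 2) := by
  have hc0 : 0 < c := by linarith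
  set A : ℕ → ℝ := fun j => Real.exp (-(((j : ℝ) + 1) * (Δ ^ 2 / (162 * c)))) with hA
  set B : ℕ → ℝ := fun j => Real.exp (-(((j : ℝ) + 1) * (Δ ^ 2 / (36 * c)))) with hB
  set I : ℕ → ℝ := fun j => if j < ⌊18 * c / Δ ^ 2⌋₊ then 1 else 0 with hI
  have hI0 : ∀ j, 0 ≤ I j := fun j => by simp only [hI]; split_ifs <;> norm_num
  have hterm : ∀ j ∈ Finset.range T,
      ∫⁻ y, ENNReal.ofReal (armOdds c (armMean D i - Δ / 3) (rewards y i) j) ∂jointLaw D ≤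
      ENNReal.ofReal (60 * I j + (2 * A j + 8 * B j)) := by
    intro j _
    by_cases h : j < ⌊18 * c / Δ ^ 2⌋₊
    · refine (lintegral_armOdds_le hc hD hΔ.le j).trans (ENNReal.ofReal_le_ofReal ?_)
      have : I j = 1 := if_pos h
      rw [this]
      have : 0 ≤ 2 * A j + 8 * B j := by positivity
      linarith
    · refine (lintegral_armOdds_le_exp hc hD hΔ hΔ1 ?_).trans (ENNReal.ofReal_le_ofReal ?_)
      · rw [← div_le_iff₀ (by positivity)]
        refine (Nat.lt_floor_add_one _).le.trans ?_
        gcongr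
        omega
      · exact le_add_of_nonneg_left (mul_nonneg (by norm_num) (hI0 j))
  refine (Finset.sum_le_sum hterm).trans ?_
  rw [← ENNReal.ofReal_sum_of_nonneg fun j _ =>
    add_nonneg (mul_nonneg (by norm_num) (hI0 j)) (by positivity)]
  refine ENNReal.ofReal_le_ofReal ?_
  rw [Finset.sum_add_distrib, Finset.sum_add_distrib, ← Finset.mul_sum, ← Finset.mul_sum,
    ← Finset.mul_sum]
  have hAs : ∑ j ∈ Finset.range T, A j ≤ 162 * c / Δ ^ 2 :=
    (sum_exp_neg_succ_mul_le (by positivity) T).trans (by rw [one_div_div])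
  have hBs : ∑ j ∈ Finset.range T, B j ≤ 36 * c / Δ ^ 2 :=
    (sum_exp_neg_succ_mul_le (by positivity) T).trans (by rw [one_div_div])
  have hIs : ∑ j ∈ Finset.range T, I j ≤ 18 * c / Δ ^ 2 := by
    refine le_trans ?_ (Nat.floor_le (show 0 ≤ 18 * c / Δ ^ 2 by positivity))
    simp only [hI, Finset.sum_boole, Nat.cast_le]
    refine (Finset.card_le_card fun j hj => ?_).trans (Finset.card_range _).le
    simpa using (Finset.mem_filter.1 hj).2
  -- The constant is `60·18 + 2·162 + 8·36 = 1692`.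
  have e1 : 162 * c / Δ ^ 2 = 162 * (c / Δ ^ 2) := by ring
  have e2 : 36 * c / Δ ^ 2 = 36 * (c / Δ ^ 2) := by ring
  have e3 : 18 * c / Δ ^ 2 = 18 * (c / Δ ^ 2) := by ring
  have e4 : 1692 * c / Δ ^ 2 = 1692 * (c / Δ ^ 2) := by ring
  rw [e4]; rw [e1] at hAs; rw [e2] at hBs; rw [e3] at hIs
  linarith

end Concentration

end ModifiedTS

/-! ### Probabilities of the events of a single round. -/

namespace ModifiedTS

section Pulls

variable {N : ℕ} (b : ℕ) (c : ℝ) (sel : (Fin N → ℝ) → Fin N)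

/-- The number of pulls of arm `i` in the first `t` rounds, as a random variable. -/
noncomputable abbrev pullCount (t : ℕ) (i : Fin N) (y : SampleIndex N → ℝ) : ℕ :=
  (stateAfter b c sel (rewards y) (noises y) t).count i

/-- The arm of round `t`, as a random variable. -/
noncomputable abbrev playedArm (t : ℕ) (y : SampleIndex N → ℝ) : Fin N := armAt b c sel (rewards y) (noises y) t

/-- The posterior sample of arm `i` in round `t`, as a random variable. -/
noncomputable abbrev posteriorSample (t : ℕ) (i : Fin N) (y : SampleIndex N → ℝ) : ℝ :=
  theta c (stateAfter b c sel (rewards y) (noises y) t) (noises y t) i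

variable {b c sel}

theorem posteriorSample_update_self (t : ℕ) (i : Fin N) (y : SampleIndex N → ℝ) (u : ℝ) :
    posteriorSample b c sel t i (Function.update y (Sum.inr (t, i)) u) =
      offsetMean (rewards y i) (pullCount b c sel t i y) +
        √(c / ((pullCount b c sel t i y : ℝ) + 1)) * u := by
  rw [posteriorSample, stateAfter_update_noise, theta_stateAfter]
  simp [noises]

theorem posteriorSample_update_of_ne (t : ℕ) {i j : Fin N} (h : j ≠ i) (y : SampleIndex N → ℝ)
    (u : ℝ) :
    posteriorSample b c sel t j (Function.update y (Sum.inr (t, i)) u) =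
      posteriorSample b c sel t j y := by
  rw [posteriorSample, stateAfter_update_noise]
  simp [theta, noises, h]

theorem pullCount_update (t : ℕ) (i j : Fin N) (y : SampleIndex N → ℝ) (u : ℝ) :
    pullCount b c sel t j (Function.update y (Sum.inr (t, i)) u) = pullCount b c sel t j y := by
  rw [pullCount, stateAfter_update_noise]

theorem rewards_update_noise (t : ℕ) (i : Fin N) (y : SampleIndex N → ℝ) (u : ℝ) :
    rewards (Function.update y (Sum.inr (t, i)) u) = rewards y := by
  ext j k; simp [rewards]

theorem posterior_le_iff (hc : 0 < c) (m v u : ℝ) (n : ℕ) :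
    m + √(c / ((n : ℝ) + 1)) * u ≤ v ↔ u ≤ (v - m) * √(((n : ℝ) + 1) / c) := by
  have h1 : √(((n : ℝ) + 1) / c) = (√(c / ((n : ℝ) + 1)))⁻¹ := by
    rw [← Real.sqrt_inv, inv_div]
  have h2 : 0 < √(c / ((n : ℝ) + 1)) := by positivity
  rw [h1, ← div_eq_mul_inv, le_div_iff₀ h2, le_sub_iff_add_le, add_comm, mul_comm]

variable {D : Fin N → Measure ℝ} [∀ i, IsProbabilityMeasure (D i)]

theorem measure_posterior_le (hc : 0 < c) (m v : ℝ) (n : ℕ) :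
    gaussianReal 0 1 {u | m + √(c / ((n : ℝ) + 1)) * u ≤ v} =
      ENNReal.ofReal (1 - gaussTail ((v - m) * √(((n : ℝ) + 1) / c))) := by
  have h : {u | m + √(c / ((n : ℝ) + 1)) * u ≤ v} = Set.Iic ((v - m) * √(((n : ℝ) + 1) / c)) :=
    Set.ext fun u => posterior_le_iff hc m v u n
  rw [h, one_sub_gaussTail, ofReal_measureReal]

theorem measure_lt_posterior (hc : 0 < c) (m v : ℝ) (n : ℕ) :
    gaussianReal 0 1 {u | v < m + √(c / ((n : ℝ) + 1)) * u} =
      ENNReal.ofReal (gaussTail ((v - m) * √(((n : ℝ) + 1) / c))) := by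
  have h : {u | v < m + √(c / ((n : ℝ) + 1)) * u} = Set.Ioi ((v - m) * √(((n : ℝ) + 1) / c)) :=
    Set.ext fun u => by
      rw [Set.mem_ofPred_eq, Set.mem_Ioi, ← not_le, posterior_le_iff hc, not_le]
  rw [h, gaussTail, ofReal_measureReal]

theorem measurable_armOdds_pullCount (hsel : Measurable sel) (v : ℝ) (t : ℕ) (i : Fin N) :
    Measurable fun y : SampleIndex N → ℝ =>
      armOdds c v (rewards y i) (pullCount b c sel t i y) := by
  refine measurable_comp_countable (f := fun (y : SampleIndex N → ℝ) k =>
    armOdds c v (rewards y i) k) (fun k => ?_) (measurable_count hsel t i)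
  have := measurable_offsetMean i k
  exact gaussOdds_mono.measurable.comp ((measurable_const.sub this).mul_const _)

theorem armAt_eq_sel {t : ℕ} (ht : b * N ≤ t) (y : SampleIndex N → ℝ) :
    playedArm b c sel t y = sel fun i => posteriorSample b c sel t i y := by
  simp only [playedArm, armAt, choose, dif_neg (not_lt.2 ht)]

/-- Playing a bad arm whose posterior sample is below `v` is, up to the posterior odds, at most as
likely as playing the arm `a`. -/
theorem measure_playedArm_le (hc : 0 < c) (hsel : IsArgmaxRule sel) {t : ℕ} (ht : b * N ≤ t)
    (i a : Fin N) (v : ℝ) :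
    jointLaw D {y | playedArm b c sel t y = i ∧ posteriorSample b c sel t i y ≤ v} ≤
      ∫⁻ y, {y | playedArm b c sel t y = a}.indicator (fun y =>
        ENNReal.ofReal (armOdds c v (rewards y a) (pullCount b c sel t a y))) y ∂jointLaw D := by
  set Q : Set (SampleIndex N → ℝ) := {y | ∀ j, j ≠ a → posteriorSample b c sel t j y ≤ v} with hQ
  set O : (SampleIndex N → ℝ) → ENNReal := fun y =>
    ENNReal.ofReal (armOdds c v (rewards y a) (pullCount b c sel t a y)) with hO
  have hθ := fun j => measurable_theta (b := b) (c := c) hsel.measurable t j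
  have hQm : MeasurableSet Q := by
    simp only [hQ, Set.ofPred_forall]
    exact MeasurableSet.iInter fun j => MeasurableSet.iInter fun _ =>
      measurableSet_le (hθ j) measurable_const
  have hOm : Measurable O := (measurable_armOdds_pullCount hsel.measurable v t a).ennreal_ofReal
  set S := Q ∩ {y | posteriorSample b c sel t a y ≤ v} with hS
  set S' := Q ∩ {y | v < posteriorSample b c sel t a y} with hS'
  have hSm : MeasurableSet S := hQm.inter (measurableSet_le (hθ a) measurable_const)
  have hSm' : MeasurableSet S' := hQm.inter (measurableSet_lt measurable_const (hθ a))
  have hupQ : ∀ y u, Function.update y (Sum.inr (t, a)) u ∈ Q ↔ y ∈ Q := by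
    intro y u
    refine forall₂_congr fun j hj => ?_
    rw [posteriorSample_update_of_ne t hj]
  have hupO : ∀ y u, O (Function.update y (Sum.inr (t, a)) u) = O y := by
    intro y u
    simp only [hO]
    rw [pullCount_update, rewards_update_noise]
  have hlaw : sampleLaw D (Sum.inr (t, a)) = gaussianReal 0 1 := rfl
  calc _ ≤ jointLaw D S := by
        refine measure_mono fun y hy => ?_
        have h : ∀ j, posteriorSample b c sel t j y ≤ v := fun j => by
          refine le_trans ?_ hy.2
          have h1 := hsel.le_sel (fun i => posteriorSample b c sel t i y) j
          rwa [← armAt_eq_sel (b := b) (c := c) (sel := sel) ht y, hy.1] at h1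
        exact ⟨fun j _ => h j, h a⟩
    _ = ∫⁻ y, S.indicator 1 y ∂jointLaw D := (lintegral_indicator_one hSm).symm
    -- Neither `Q` nor `O` sees the resampled noise, so given the rest this is the identity (odds) ·
    -- (tail) = 1 - (tail).
    _ = ∫⁻ y, S'.indicator O y ∂jointLaw D := by
        rw [Measure.lintegral_infinitePi_update _ (Sum.inr (t, a))
          (measurable_one.indicator hSm), Measure.lintegral_infinitePi_update _ (Sum.inr (t, a))
          (hOm.indicator hSm')]
        refine lintegral_congr fun y => ?_
        rw [hlaw]
        by_cases hy : y ∈ Q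
        · set m := offsetMean (rewards y a) (pullCount b c sel t a y)
          set n := pullCount b c sel t a y
          have h1 : ∀ u, S.indicator (1 : (SampleIndex N → ℝ) → ENNReal) (Function.update y (Sum.inr (t, a)) u) =
              {u | m + √(c / ((n : ℝ) + 1)) * u ≤ v}.indicator 1 u := by
            intro u
            have : Function.update y (Sum.inr (t, a)) u ∈ S ↔
                u ∈ {u | m + √(c / ((n : ℝ) + 1)) * u ≤ v} := by
              rw [hS, Set.mem_inter_iff, hupQ, and_iff_right hy, Set.mem_ofPred_eq,
                posteriorSample_update_self, Set.mem_ofPred_eq]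
            simp only [Set.indicator, this, Pi.one_apply]
          have h2 : ∀ u, S'.indicator O (Function.update y (Sum.inr (t, a)) u) =
              {u | v < m + √(c / ((n : ℝ) + 1)) * u}.indicator (fun _ => O y) u := by
            intro u
            have : Function.update y (Sum.inr (t, a)) u ∈ S' ↔
                u ∈ {u | v < m + √(c / ((n : ℝ) + 1)) * u} := by
              rw [hS', Set.mem_inter_iff, hupQ, and_iff_right hy, Set.mem_ofPred_eq,
                posteriorSample_update_self, Set.mem_ofPred_eq]
            simp only [Set.indicator, this, hupO]
          rw [lintegral_congr h1, lintegral_congr h2]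
          rw [lintegral_indicator_one (measurableSet_le (by fun_prop) measurable_const),
            lintegral_indicator_const (measurableSet_lt measurable_const (by fun_prop)),
            measure_posterior_le hc, measure_lt_posterior hc,
            show O y = ENNReal.ofReal (gaussOdds ((v - m) * √(((n : ℝ) + 1) / c))) from rfl,
            ← ENNReal.ofReal_mul (gaussOdds_nonneg _), gaussOdds,
            div_mul_cancel₀ _ (gaussTail_pos _).ne']
        · have h1 : ∀ u, S.indicator (1 : (SampleIndex N → ℝ) → ENNReal) (Function.update y (Sum.inr (t, a)) u) = 0 :=
            fun u => Set.indicator_of_notMem (fun h => hy ((hupQ y u).1 h.1)) _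
          have h2 : ∀ u, S'.indicator O (Function.update y (Sum.inr (t, a)) u) = 0 :=
            fun u => Set.indicator_of_notMem (fun h => hy ((hupQ y u).1 h.1)) _
          rw [lintegral_congr h1, lintegral_congr h2]
    _ ≤ _ := by
        refine lintegral_mono (Set.indicator_le_indicator_of_subset (fun y hy => ?_)
          fun _ => zero_le)
        -- On `S'` only `a` has a sample above `v`, so it wins under any tie-breaking rule.
        by_contra hne
        have h1 := hsel.le_sel (fun i => posteriorSample b c sel t i y) a
        rw [← armAt_eq_sel (b := b) (c := c) (sel := sel) ht y] at h1
        exact (h1.trans (hy.1 _ hne)).not_gt hy.2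

/-- Once arm `i` has been pulled often, its posterior sample rarely exceeds its estimate much. -/
theorem measure_lt_posteriorSample_le (hc : 0 < c) (hsel : IsArgmaxRule sel) (t : ℕ) (i : Fin N)
    {m v L : ℝ} (hmv : m ≤ v) (hL : 0 ≤ L) :
    jointLaw D {y | (L ≤ (pullCount b c sel t i y : ℝ) + 1 ∧
        offsetMean (rewards y i) (pullCount b c sel t i y) ≤ m) ∧
        v < posteriorSample b c sel t i y} ≤
      ENNReal.ofReal (Real.exp (-(L * (v - m) ^ 2 / (2 * c)))) := by
  set Q : Set (SampleIndex N → ℝ) := {y | L ≤ (pullCount b c sel t i y : ℝ) + 1 ∧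
        offsetMean (rewards y i) (pullCount b c sel t i y) ≤ m} with hQ
  have hθ := measurable_theta (b := b) (c := c) hsel.measurable t i
  have hn := measurable_count (b := b) (c := c) hsel.measurable t i
  have hmean : Measurable fun y : SampleIndex N → ℝ =>
      offsetMean (rewards y i) (pullCount b c sel t i y) :=
    measurable_comp_countable (f := fun (y : SampleIndex N → ℝ) k => offsetMean (rewards y i) k)
      (measurable_offsetMean i) hn
  have hQm : MeasurableSet Q :=
    (measurableSet_le measurable_const ((measurable_from_nat (f := fun n : ℕ => (n : ℝ))).comp
      hn |>.add_const 1)).inter (measurableSet_le hmean measurable_const)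
  have hSm : MeasurableSet (Q ∩ {y | v < posteriorSample b c sel t i y}) :=
    hQm.inter (measurableSet_lt measurable_const hθ)
  have hlaw : sampleLaw D (Sum.inr (t, i)) = gaussianReal 0 1 := rfl
  change jointLaw D (Q ∩ {y | v < posteriorSample b c sel t i y}) ≤ _
  -- `Q` is decided before the noise of round `t` is drawn; integrating that noise out leaves a
  -- Gaussian tail.
  rw [← lintegral_indicator_one hSm, Measure.lintegral_infinitePi_update _ (Sum.inr (t, i))
          (measurable_one.indicator hSm), hlaw]
  calc _ ≤ ∫⁻ _, ENNReal.ofReal (Real.exp (-(L * (v - m) ^ 2 / (2 * c)))) ∂jointLaw D := by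
        refine lintegral_mono fun y => ?_
        by_cases hy : y ∈ Q
        · have h1 : ∀ u, (Q ∩ {y | v < posteriorSample b c sel t i y}).indicator
              (1 : (SampleIndex N → ℝ) → ENNReal) (Function.update y (Sum.inr (t, i)) u) ≤
              {u | v < offsetMean (rewards y i) (pullCount b c sel t i y) +
                √(c / ((pullCount b c sel t i y : ℝ) + 1)) * u}.indicator 1 u := by
            intro u
            by_cases h : Function.update y (Sum.inr (t, i)) u ∈
              Q ∩ {y | v < posteriorSample b c sel t i y}
            swap
            · rw [Set.indicator_of_notMem h]; exact zero_le
            rw [Set.indicator_of_mem h]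
            have h2 := h.2
            rw [Set.mem_ofPred_eq, posteriorSample_update_self] at h2
            exact (Set.indicator_of_mem (s := {u | v < offsetMean (rewards y i)
                (pullCount b c sel t i y) + √(c / ((pullCount b c sel t i y : ℝ) + 1)) * u})
              h2 (1 : ℝ → ENNReal)).ge
          refine (lintegral_mono h1).trans ?_
          rw [lintegral_indicator_one (measurableSet_lt measurable_const (by fun_prop)),
            measure_lt_posterior hc]
          refine ENNReal.ofReal_le_ofReal ?_
          have h3 : m ≤ v := hmv
          have h4 : offsetMean (rewards y i) (pullCount b c sel t i y) ≤ m := hy.2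
          refine (gaussTail_le_exp (mul_nonneg (by linarith) (Real.sqrt_nonneg _))).trans
            (Real.exp_le_exp.2 (neg_le_neg ?_))
          rw [mul_pow, Real.sq_sqrt (by positivity)]
          have h5 : (v - m) ^ 2 ≤
              (v - offsetMean (rewards y i) (pullCount b c sel t i y)) ^ 2 :=
            pow_le_pow_left₀ (by linarith) (by linarith) 2
          calc L * (v - m) ^ 2 / (2 * c) = (v - m) ^ 2 * (L / c) / 2 := by field_simp
            _ ≤ _ := by gcongr; exact hy.1
        · have h1 : ∀ u, (Q ∩ {y | v < posteriorSample b c sel t i y}).indicator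
              (1 : (SampleIndex N → ℝ) → ENNReal) (Function.update y (Sum.inr (t, i)) u) = 0 := by
            intro u
            refine Set.indicator_of_notMem (fun h => hy ?_) _
            have h2 := h.1
            rwa [hQ, Set.mem_ofPred_eq, pullCount_update, rewards_update_noise] at h2
          rw [lintegral_congr h1]
          simp
    _ = _ := by simp

/-- Every pull count of an arm occurs in at most one of the rounds in which the arm is played. -/
theorem sum_lintegral_playedArm_le (hsel : Measurable sel) (i : Fin N) (s T : ℕ)
    {F : ℕ → (SampleIndex N → ℝ) → ENNReal} (hF : ∀ k, Measurable (F k)) :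
    ∑ t ∈ Finset.Ico s T, ∫⁻ y, {y | playedArm b c sel t y = i}.indicator
        (fun y => F (pullCount b c sel t i y) y) y ∂jointLaw D ≤
      ∑ k ∈ Finset.range T, ∫⁻ y, F k y ∂jointLaw D := by
  have hm : ∀ t, Measurable ({y | playedArm b c sel t y = i}.indicator
        (fun y => F (pullCount b c sel t i y) y)) := fun t =>
    (measurable_comp_countable (f := fun y k => F k y) hF (measurable_count hsel t i)).indicator
      (measurable_armAt hsel t (measurableSet_singleton i))
  calc _ ≤ ∑ t ∈ Finset.range T, ∫⁻ y, {y | playedArm b c sel t y = i}.indicator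
        (fun y => F (pullCount b c sel t i y) y) y ∂jointLaw D :=
        Finset.sum_le_sum_of_subset fun t ht => by simp at ht ⊢; omega
    _ = ∫⁻ y, ∑ t ∈ Finset.range T, {y | playedArm b c sel t y = i}.indicator
        (fun y => F (pullCount b c sel t i y) y) y ∂jointLaw D :=
        (lintegral_finsetSum _ fun t _ => hm t).symm
    _ ≤ ∫⁻ y, ∑ k ∈ Finset.range T, F k y ∂jointLaw D := by
        refine lintegral_mono fun y => ?_
        have h := sum_pulls b c sel (rewards y) (noises y) i (fun k => F k y) T
        simp only [Set.indicator, Set.mem_ofPred_eq]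
        refine h.le.trans (Finset.sum_le_sum_of_subset fun k hk => ?_)
        have := count_le b c sel (rewards y) (noises y) T i
        simp at hk ⊢
        omega
    _ = _ := lintegral_finsetSum _ fun k _ => hF k

end Pulls

end ModifiedTS

/-! ### Expected pulls of a bad arm. -/

namespace ModifiedTS

section PullBound

variable {N b : ℕ} {c : ℝ} {sel : (Fin N → ℝ) → Fin N}
variable {D : Fin N → Measure ℝ} [∀ i, IsProbabilityMeasure (D i)]

theorem sum_measure_lt_offsetMean_le {i : Fin N} (hD : ∀ᵐ y ∂(D i), y ∈ Set.Icc (0 : ℝ) 1)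
    {ε : ℝ} (hε : 0 < ε) (T : ℕ) :
    ∑ k ∈ Finset.range T, jointLaw D {y | armMean D i + ε < offsetMean (rewards y i) k} ≤
      ENNReal.ofReal (1 / (2 * ε ^ 2)) := by
  -- With no pulls the estimate is `0`, never above `armMean D i + ε`. Removing this term lets the
  -- geometric sum start at exponent one.
  have h0 : jointLaw D {y | armMean D i + ε < offsetMean (rewards y i) 0} = 0 := by
    have : {y : SampleIndex N → ℝ | armMean D i + ε < offsetMean (rewards y i) 0} = ∅ := by
      have := (armMean_mem_Icc hD).1
      ext y
      simp only [offsetMean, Finset.range_zero, Finset.sum_empty, zero_div, Set.mem_ofPred_eq,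
        Set.mem_empty_iff_false, iff_false, not_lt]
      linarith
    rw [this, measure_empty]
  calc _ ≤ ∑ k ∈ Finset.range (T + 1),
        jointLaw D {y | armMean D i + ε < offsetMean (rewards y i) k} :=
        Finset.sum_le_sum_of_subset (Finset.range_mono (Nat.le_succ T))
    _ = ∑ k ∈ Finset.range T,
        jointLaw D {y | armMean D i + ε < offsetMean (rewards y i) (k + 1)} := by
        rw [Finset.sum_range_succ', h0, add_zero]
    _ ≤ ∑ k ∈ Finset.range T, ENNReal.ofReal (Real.exp (-(((k : ℝ) + 1) * (2 * ε ^ 2)))) := by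
        refine Finset.sum_le_sum fun k _ => ?_
        have h := measureReal_lt_offsetMean_le hD (k + 1) hε.le
        rw [← ofReal_measureReal]
        refine ENNReal.ofReal_le_ofReal ?_
        simpa using h
    _ ≤ _ := by
        rw [← ENNReal.ofReal_sum_of_nonneg fun k _ => (Real.exp_pos _).le]
        exact ENNReal.ofReal_le_ofReal (sum_exp_neg_succ_mul_le (by positivity) T)

theorem sum_range_ite_lt_le {L : ℝ} (hL : 0 ≤ L) (T : ℕ) :
    (∑ k ∈ Finset.range T, if (k : ℝ) + 1 < L then (1 : ENNReal) else 0) ≤ ENNReal.ofReal L := by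
  rw [Finset.sum_boole]
  have h : (Finset.filter (fun k : ℕ => (k : ℝ) + 1 < L) (Finset.range T)).card ≤ ⌊L⌋₊ := by
    refine (Finset.card_le_card fun k hk => ?_).trans (Finset.card_range _).le
    have h1 := (Finset.mem_filter.1 hk).2
    rw [Finset.mem_range]
    exact Nat.le_floor (by push_cast; linarith)
  calc _ ≤ ((⌊L⌋₊ : ℕ) : ENNReal) := by exact_mod_cast h
    _ = ENNReal.ofReal ((⌊L⌋₊ : ℕ) : ℝ) := (ENNReal.ofReal_natCast _).symm
    _ ≤ _ := ENNReal.ofReal_le_ofReal (Nat.floor_le hL)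

/-- The pulls of a bad arm `i` after the pre-pulls, when `L` is the number of pulls after which
its posterior is considered as concentrated. -/
theorem lintegral_pullCount_le (hc : 1 ≤ c) (hsel : IsArgmaxRule sel)
    (hD : ∀ i, ∀ᵐ y ∂(D i), y ∈ Set.Icc (0 : ℝ) 1) {T : ℕ} (hT : b * N ≤ T) (i a : Fin N)
    {Δ : ℝ} (hΔ : 0 < Δ) (hΔa : armMean D a = armMean D i + Δ) {L : ℝ} (hL : 0 ≤ L) :
    ∫⁻ y, (pullCount b c sel T i y : ENNReal) ∂jointLaw D ≤
      b + (ENNReal.ofReal (1 / (2 * (Δ / 3) ^ 2)) + ENNReal.ofReal L +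
        (T - b * N : ℕ) * ENNReal.ofReal (Real.exp (-(L * (Δ / 3) ^ 2 / (2 * c)))) +
        ENNReal.ofReal (1692 * c / Δ ^ 2)) := by
  have hc0 : 0 < c := by linarith
  have hΔ1 : Δ ≤ 1 := by
    have := (armMean_mem_Icc (hD a)).2
    have := (armMean_mem_Icc (hD i)).1
    linarith
  set m := armMean D i + Δ / 3 with hm
  set v := armMean D a - Δ / 3 with hv
  have hvm : v - m = Δ / 3 := by rw [hv, hm, hΔa]; ring
  have hmeas : ∀ t, Measurable (playedArm b c sel t) := fun t =>
    measurable_armAt (b := b) (c := c) hsel.measurable t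
  have hmean : ∀ k, Measurable fun y : SampleIndex N → ℝ => offsetMean (rewards y i) k :=
    measurable_offsetMean i
  set F : ℕ → (SampleIndex N → ℝ) → ENNReal := fun k =>
    {y | m < offsetMean (rewards y i) k}.indicator 1 with hF
  set G : ℕ → (SampleIndex N → ℝ) → ENNReal := fun k _ =>
    if (k : ℝ) + 1 < L then 1 else 0 with hG
  set H : ℕ → (SampleIndex N → ℝ) → ENNReal := fun k y =>
    ENNReal.ofReal (armOdds c v (rewards y a) k) with hH
  have hFm : ∀ k, Measurable (F k) := fun k =>
    measurable_one.indicator (measurableSet_lt measurable_const (hmean k))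
  have hGm : ∀ k, Measurable (G k) := fun k => measurable_const
  have hHm : ∀ k, Measurable (H k) := fun k => by
    have := measurable_offsetMean (N := N) a k
    exact (gaussOdds_mono.measurable.comp ((measurable_const.sub this).mul_const _)).ennreal_ofReal
  set A : ℕ → Set (SampleIndex N → ℝ) := fun t => {y | playedArm b c sel t y = i} with hA
  have hAm : ∀ t, MeasurableSet (A t) := fun t => hmeas t (measurableSet_singleton i)
  set B : ℕ → Set (SampleIndex N → ℝ) := fun t =>
    {y | (L ≤ (pullCount b c sel t i y : ℝ) + 1 ∧
        offsetMean (rewards y i) (pullCount b c sel t i y) ≤ m) ∧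
        v < posteriorSample b c sel t i y} with hB
  set E : ℕ → Set (SampleIndex N → ℝ) := fun t =>
    {y | playedArm b c sel t y = i ∧ posteriorSample b c sel t i y ≤ v} with hE
  -- The four causes in order: estimate too high, too few pulls, sample above `v`, sample at most
  -- `v`.
  have hcover : ∀ t y, (A t).indicator (1 : (SampleIndex N → ℝ) → ENNReal) y ≤
      (A t).indicator (fun y => F (pullCount b c sel t i y) y) y +
        (A t).indicator (fun y => G (pullCount b c sel t i y) y) y +
        (B t).indicator 1 y + (E t).indicator 1 y := by
    intro t y
    by_cases hy : y ∈ A t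
    swap
    · rw [Set.indicator_of_notMem hy]; exact zero_le
    rw [Set.indicator_of_mem hy, Set.indicator_of_mem hy, Set.indicator_of_mem hy]
    by_cases h1 : m < offsetMean (rewards y i) (pullCount b c sel t i y)
    · have : F (pullCount b c sel t i y) y = 1 := Set.indicator_of_mem (s := {y |
        m < offsetMean (rewards y i) (pullCount b c sel t i y)}) h1 _
      rw [this, Pi.one_apply, add_assoc, add_assoc]
      exact le_self_add
    by_cases h2 : (pullCount b c sel t i y : ℝ) + 1 < L
    · have : G (pullCount b c sel t i y) y = 1 := if_pos h2
      rw [this, Pi.one_apply, add_comm (F _ y), add_assoc, add_assoc]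
      exact le_self_add
    by_cases h3 : v < posteriorSample b c sel t i y
    · have : y ∈ B t := ⟨⟨not_lt.1 h2, not_lt.1 h1⟩, h3⟩
      rw [Set.indicator_of_mem this, add_right_comm]
      exact le_add_self
    · have : y ∈ E t := ⟨hy, not_lt.1 h3⟩
      rw [Set.indicator_of_mem this]
      exact le_add_self
  have hθ := fun t => measurable_theta (b := b) (c := c) hsel.measurable t i
  have hcm := fun t => measurable_count (b := b) (c := c) hsel.measurable t i
  have hcomp : ∀ (F : ℕ → (SampleIndex N → ℝ) → ENNReal), (∀ k, Measurable (F k)) → ∀ t,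
      Measurable ((A t).indicator fun y => F (pullCount b c sel t i y) y) := fun F hF t =>
    (measurable_comp_countable (f := fun y k => F k y) hF (hcm t)).indicator (hAm t)
  have hBm : ∀ t, MeasurableSet (B t) := fun t =>
    ((measurableSet_le measurable_const ((measurable_from_nat (f := fun n : ℕ => (n : ℝ))).comp
      (hcm t) |>.add_const 1)).inter (measurableSet_le (measurable_comp_countable
        (f := fun (y : SampleIndex N → ℝ) k => offsetMean (rewards y i) k) hmean (hcm t))
        measurable_const)).inter (measurableSet_lt measurable_const (hθ t))
  have hEm : ∀ t, MeasurableSet (E t) := fun t =>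
    (hAm t).inter (measurableSet_le (hθ t) measurable_const)
  have hround : ∀ t, ∫⁻ y, (A t).indicator 1 y ∂jointLaw D ≤
      ∫⁻ y, (A t).indicator (fun y => F (pullCount b c sel t i y) y) y ∂jointLaw D +
      ∫⁻ y, (A t).indicator (fun y => G (pullCount b c sel t i y) y) y ∂jointLaw D +
      jointLaw D (B t) + jointLaw D (E t) := by
    intro t
    refine (lintegral_mono (hcover t)).trans (le_of_eq ?_)
    rw [lintegral_add_right _ (measurable_one.indicator (hEm t)),
      lintegral_add_right _ (measurable_one.indicator (hBm t)),
      lintegral_add_right _ (hcomp G hGm t), lintegral_indicator_one (hEm t),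
      lintegral_indicator_one (hBm t)]
  calc _ = ∫⁻ y, (b + ∑ t ∈ Finset.Ico (b * N) T, (A t).indicator 1 y : ENNReal) ∂jointLaw D := by
        refine lintegral_congr fun y => ?_
        rw [pullCount, count_eq_add_sum b c sel _ _ i hT]
        push_cast
        simp only [Set.indicator, hA, Set.mem_ofPred_eq, Pi.one_apply]
    _ = b + ∑ t ∈ Finset.Ico (b * N) T, ∫⁻ y, (A t).indicator 1 y ∂jointLaw D := by
        rw [lintegral_add_left measurable_const, lintegral_const, measure_univ, mul_one,
          lintegral_finsetSum _ fun t _ => measurable_one.indicator (hAm t)]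
    _ ≤ b + ∑ t ∈ Finset.Ico (b * N) T,
        (∫⁻ y, (A t).indicator (fun y => F (pullCount b c sel t i y) y) y ∂jointLaw D +
        ∫⁻ y, (A t).indicator (fun y => G (pullCount b c sel t i y) y) y ∂jointLaw D +
        jointLaw D (B t) + jointLaw D (E t)) := by
        gcongr with t
        exact hround t
    _ ≤ _ := by
        simp only [Finset.sum_add_distrib]
        gcongr
        · refine (sum_lintegral_playedArm_le hsel.measurable i _ T hFm).trans ?_
          refine le_trans (le_of_eq (Finset.sum_congr rfl fun k _ => ?_))
            (sum_measure_lt_offsetMean_le (hD i) (by positivity : 0 < Δ / 3) T)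
          exact lintegral_indicator_one (measurableSet_lt measurable_const (hmean k))
        · refine (sum_lintegral_playedArm_le hsel.measurable i _ T hGm).trans ?_
          refine le_trans (le_of_eq (Finset.sum_congr rfl fun k _ => ?_))
            (sum_range_ite_lt_le hL T)
          rw [hG, lintegral_const, measure_univ, mul_one]
        · refine (Finset.sum_le_card_nsmul _ _ _ fun t _ =>
            measure_lt_posteriorSample_le hc0 hsel t i (by linarith : m ≤ v) hL).trans ?_
          rw [Nat.card_Ico, nsmul_eq_mul, hvm]
        · refine le_trans (Finset.sum_le_sum fun t ht => measure_playedArm_le hc0 hsel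
            (Finset.mem_Ico.1 ht).1 i a v) ?_
          exact (sum_lintegral_playedArm_le hsel.measurable a _ T hHm).trans
            (sum_lintegral_armOdds_le hc (hD a) hΔ hΔ1 T)

theorem integrable_pullCount (hsel : Measurable sel) (T : ℕ) (i : Fin N) :
    Integrable (fun y => (pullCount b c sel T i y : ℝ)) (jointLaw D) := by
  refine Integrable.of_mem_Icc 0 T ((measurable_from_nat (f := fun n : ℕ => (n : ℝ))).comp
    (measurable_count hsel T i)).aemeasurable (ae_of_all _ fun y => ⟨by positivity, ?_⟩)
  exact_mod_cast count_le b c sel _ _ T i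

/-- With `S = (T - bN) Δ²`, the choice of `L` makes the tail of a round exactly `1/S`, so all later
rounds together contribute `1/Δ²`. Since `S > 4 > e`, `log S ≥ 1` absorbs the odds term. The sum
needs only `4.5 + 1` and `18 + 1692`, below the stated `14` and `5130`. -/
theorem integral_pullCount_le (hc : 1 ≤ c) (hsel : IsArgmaxRule sel)
    (hD : ∀ i, ∀ᵐ y ∂(D i), y ∈ Set.Icc (0 : ℝ) 1) {T : ℕ} (hT : b * N ≤ T) (i a : Fin N)
    {Δ : ℝ} (hΔ : 0 < Δ) (hΔa : armMean D a = armMean D i + Δ)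
    (hTΔ : 4 < ((T : ℝ) - b * N) * Δ ^ 2) :
    ∫ y, (pullCount b c sel T i y : ℝ) ∂jointLaw D ≤
      b + 14 / Δ ^ 2 + 5130 * c / Δ ^ 2 * Real.log (((T : ℝ) - b * N) * Δ ^ 2) := by
  have hc0 : 0 < c := by linarith
  set S := ((T : ℝ) - b * N) * Δ ^ 2 with hS
  have hlog : 1 ≤ Real.log S := by
    rw [Real.le_log_iff_exp_le (by linarith)]
    linarith [Real.exp_one_lt_d9]
  set L := 18 * c * Real.log S / Δ ^ 2 with hL
  have hL0 : 0 ≤ L := by positivity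
  have h := lintegral_pullCount_le hc hsel hD hT i a hΔ hΔa hL0
  have hexp : Real.exp (-(L * (Δ / 3) ^ 2 / (2 * c))) = S⁻¹ := by
    have : L * (Δ / 3) ^ 2 / (2 * c) = Real.log S := by
      rw [hL]; field_simp; norm_num
    rw [this, Real.exp_neg, Real.exp_log (by linarith)]
  have hTcast : ((T - b * N : ℕ) : ENNReal) = ENNReal.ofReal ((T : ℝ) - b * N) := by
    rw [← ENNReal.ofReal_natCast, Nat.cast_sub hT]
    push_cast; rfl
  have hT0 : 0 < (T : ℝ) - b * N := by
    by_contra h0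
    have : ((T : ℝ) - b * N) * Δ ^ 2 ≤ 0 := mul_nonpos_of_nonpos_of_nonneg (not_lt.1 h0)
      (sq_nonneg _)
    linarith
  rw [hexp, hTcast, ← ENNReal.ofReal_natCast b, ← ENNReal.ofReal_mul hT0.le,
    ← ENNReal.ofReal_add (by positivity) hL0, ← ENNReal.ofReal_add (by positivity) (by positivity),
    ← ENNReal.ofReal_add (by positivity) (by positivity),
    ← ENNReal.ofReal_add (by positivity) (by positivity)] at h
  have h2 : ∫⁻ y, (pullCount b c sel T i y : ENNReal) ∂jointLaw D =
      ENNReal.ofReal (∫ y, (pullCount b c sel T i y : ℝ) ∂jointLaw D) := by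
    rw [ofReal_integral_eq_lintegral_ofReal (integrable_pullCount hsel.measurable T i)
      (ae_of_all _ fun y => Nat.cast_nonneg _)]
    simp
  rw [h2, ENNReal.ofReal_le_ofReal_iff (by positivity)] at h
  refine h.trans ?_
  have e1 : 1 / (2 * (Δ / 3) ^ 2) = 4.5 * (1 / Δ ^ 2) := by field_simp; norm_num
  have e2 : ((T : ℝ) - b * N) * S⁻¹ = 1 / Δ ^ 2 := by rw [hS]; field_simp
  have e3 : 1692 * c / Δ ^ 2 = 1692 * (c / Δ ^ 2) := by ring
  have e4 : L = 18 * (c / Δ ^ 2 * Real.log S) := by rw [hL]; ring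
  have e5 : 14 / Δ ^ 2 = 14 * (1 / Δ ^ 2) := by ring
  have e6 : 5130 * c / Δ ^ 2 * Real.log S = 5130 * (c / Δ ^ 2 * Real.log S) := by ring
  rw [e1, e2, e3, e4, e5, e6]
  have h3 : c / Δ ^ 2 ≤ c / Δ ^ 2 * Real.log S := le_mul_of_one_le_right (by positivity) hlog
  have h4 : 0 ≤ 1 / Δ ^ 2 := by positivity
  have h5 : 0 ≤ c / Δ ^ 2 := by positivity
  linarith

end PullBound

end ModifiedTS

/-! ### Regret as a gap-weighted sum of pulls, and transfer to an arbitrary probability space. -/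

namespace ModifiedTS

section Regret

variable {N b : ℕ} {c : ℝ} {sel : (Fin N → ℝ) → Fin N}
variable {D : Fin N → Measure ℝ} [∀ i, IsProbabilityMeasure (D i)]

theorem integrable_reward {i : Fin N} (hD : ∀ᵐ y ∂(D i), y ∈ Set.Icc (0 : ℝ) 1) (k : ℕ) :
    Integrable (fun y => rewards y i k) (jointLaw D) := by
  rw [← map_reward_jointLaw (D := D) i k] at hD
  exact Integrable.of_mem_Icc 0 1 (measurable_pi_apply _).aemeasurable
    (ae_of_ae_map (measurable_pi_apply _).aemeasurable hD)

theorem measurableSet_lt_pullCount (hsel : Measurable sel) (T k : ℕ) (i : Fin N) :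
    MeasurableSet {y : SampleIndex N → ℝ | k < pullCount b c sel T i y} :=
  measurable_count hsel T i (measurableSet_Ioi (a := k))

/-- A reward is independent of whether it is collected. -/
theorem integral_collected_reward (hsel : Measurable sel) {i : Fin N}
    (hD : ∀ᵐ y ∂(D i), y ∈ Set.Icc (0 : ℝ) 1) (T k : ℕ) :
    ∫ y, {y | k < pullCount b c sel T i y}.indicator (fun y => rewards y i k) y ∂jointLaw D =
      armMean D i * (jointLaw D).real {y | k < pullCount b c sel T i y} := by
  set S := {y : SampleIndex N → ℝ | k < pullCount b c sel T i y} with hS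
  have hSm : MeasurableSet S := measurableSet_lt_pullCount hsel T k i
  have hint := (integrable_reward hD k).indicator hSm
  -- The decision to make pull `k` precedes its reward, so integrating out that reward alone
  -- produces the mean.
  have hup : ∀ y u, Function.update y (Sum.inl (i, k)) u ∈ S ↔ y ∈ S := by
    intro y u
    have h : noises (Function.update y (Sum.inl (i, k)) u) = noises y := by
      ext t j; simp [noises]
    simp only [hS, Set.mem_ofPred_eq, pullCount, h]
    exact lt_count_congr_reward b c sel _ (fun j l hjl => by simp [rewards, hjl]) T
  have hmap : ((jointLaw D).prod (sampleLaw D (Sum.inl (i, k)))).map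
      (fun p => Function.update p.1 (Sum.inl (i, k)) p.2) = jointLaw D :=
    Measure.infinitePi_map_update (sampleLaw D) (Sum.inl (i, k))
  have hm : Measurable fun p : (SampleIndex N → ℝ) × ℝ =>
      Function.update p.1 (Sum.inl (i, k) : SampleIndex N) p.2 := measurable_update'
  have hint' := hint
  rw [← hmap] at hint'
  have hint2 := (integrable_map_measure hint'.aestronglyMeasurable hm.aemeasurable).1 hint'
  conv_lhs => rw [← hmap]
  rw [integral_map hm.aemeasurable hint'.aestronglyMeasurable]
  refine (integral_prod _ hint2).trans ?_
  have hlaw : sampleLaw D (Sum.inl (i, k)) = D i := rfl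
  have h1 : ∀ y : SampleIndex N → ℝ, ∫ u, S.indicator (fun y => rewards y i k)
      (Function.update y (Sum.inl (i, k)) u) ∂sampleLaw D (Sum.inl (i, k)) =
      S.indicator (fun _ => armMean D i) y := by
    intro y
    rw [hlaw]
    by_cases hy : y ∈ S
    · rw [Set.indicator_of_mem hy, armMean]
      refine integral_congr_ae (ae_of_all _ fun u => ?_)
      simp only [Set.indicator_of_mem ((hup y u).2 hy)]
      simp [rewards]
    · rw [Set.indicator_of_notMem hy]
      rw [← integral_zero ℝ ℝ (μ := D i)]
      refine integral_congr_ae (ae_of_all _ fun u => ?_)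
      exact Set.indicator_of_notMem (fun h => hy ((hup y u).1 h)) _
  refine (integral_congr_ae (ae_of_all _ h1)).trans ?_
  rw [integral_indicator_const _ hSm, smul_eq_mul, mul_comm]

theorem integral_pullCount_eq_sum (hsel : Measurable sel) (T : ℕ) (i : Fin N) :
    ∫ y, (pullCount b c sel T i y : ℝ) ∂jointLaw D =
      ∑ k ∈ Finset.range T, (jointLaw D).real {y | k < pullCount b c sel T i y} := by
  have h : ∀ y : SampleIndex N → ℝ, (pullCount b c sel T i y : ℝ) =
      ∑ k ∈ Finset.range T, {y | k < pullCount b c sel T i y}.indicator (fun _ => (1 : ℝ)) y := by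
    intro y
    have h1 : pullCount b c sel T i y ≤ T := count_le b c sel (rewards y) (noises y) T i
    simp only [Set.indicator, Set.mem_ofPred_eq, Finset.sum_boole, Nat.cast_inj]
    have : Finset.filter (fun k => k < pullCount b c sel T i y) (Finset.range T) =
        Finset.range (pullCount b c sel T i y) := by
      ext k; simp; omega
    rw [this, Finset.card_range]
  simp_rw [h]
  rw [integral_finsetSum _ fun k _ =>
    (integrable_const (1 : ℝ)).indicator (measurableSet_lt_pullCount hsel T k i)]
  refine Finset.sum_congr rfl fun k _ => ?_
  rw [integral_indicator_const _ (measurableSet_lt_pullCount hsel T k i), smul_eq_mul, mul_one]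

theorem sum_rewardAt_eq (T : ℕ) (y : SampleIndex N → ℝ) :
    ∑ t ∈ Finset.range T, rewardAt b c sel (rewards y) (noises y) t =
      ∑ i, ∑ k ∈ Finset.range T,
        {y | k < pullCount b c sel T i y}.indicator (fun y => rewards y i k) y := by
  rw [sum_reward]
  simp only [Set.indicator, Set.mem_ofPred_eq]

theorem integral_sum_rewardAt (hsel : Measurable sel)
    (hD : ∀ i, ∀ᵐ y ∂(D i), y ∈ Set.Icc (0 : ℝ) 1) (T : ℕ) :
    ∫ y, ∑ t ∈ Finset.range T, rewardAt b c sel (rewards y) (noises y) t ∂jointLaw D =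
      ∑ i, armMean D i * ∫ y, (pullCount b c sel T i y : ℝ) ∂jointLaw D := by
  have hint : ∀ i k, Integrable ({y | k < pullCount b c sel T i y}.indicator
      (fun y => rewards y i k)) (jointLaw D) := fun i k =>
    (integrable_reward (hD i) k).indicator (measurableSet_lt_pullCount hsel T k i)
  simp_rw [sum_rewardAt_eq]
  rw [integral_finsetSum _ fun i _ => integrable_finsetSum _ fun k _ => hint i k]
  refine Finset.sum_congr rfl fun i _ => ?_
  rw [integral_finsetSum _ fun k _ => hint i k, integral_pullCount_eq_sum hsel, Finset.mul_sum]
  exact Finset.sum_congr rfl fun k _ => integral_collected_reward hsel (hD i) T k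

theorem sum_integral_pullCount (hsel : Measurable sel) (T : ℕ) :
    ∑ i, ∫ y, (pullCount b c sel T i y : ℝ) ∂jointLaw D = T := by
  rw [← integral_finsetSum _ fun i _ => integrable_pullCount hsel T i]
  have : ∀ y : SampleIndex N → ℝ, ∑ i, (pullCount b c sel T i y : ℝ) = T := fun y => by
    exact_mod_cast sum_count b c sel (rewards y) (noises y) T
  simp_rw [this]
  simp

theorem le_integral_pullCount (hsel : Measurable sel) {T : ℕ} (hT : b * N ≤ T) (i : Fin N) :
    (b : ℝ) ≤ ∫ y, (pullCount b c sel T i y : ℝ) ∂jointLaw D := by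
  have h := integral_mono (μ := jointLaw D) (integrable_const (b : ℝ))
    (integrable_pullCount (b := b) (c := c) hsel T i) (fun y => by
      have h := count_mono b c sel (rewards y) (noises y) i hT
      simp only [count_prephase_end] at h
      exact Nat.cast_le.2 h)
  simpa using h

section Transfer

variable {Ω : Type*} [MeasurableSpace Ω] {P : Measure Ω}
  {X : Fin N → ℕ → Ω → ℝ} {Z : ℕ → Fin N → Ω → ℝ}


/-- Pulls and regret are functionals of the primitive variables, so this joint law reduces every
expectation to the canonical space. -/
theorem IsBanditSample.hasLaw (h : IsBanditSample P D X Z) :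
    HasLaw (fun ω (p : SampleIndex N) =>
      Sum.elim (fun p : Fin N × ℕ => X p.1 p.2 ω) (fun p : ℕ × Fin N => Z p.1 p.2 ω) p)
      (jointLaw D) P := by
  have hX : ∀ p, HasLaw (Sum.elim (fun p : Fin N × ℕ => X p.1 p.2)
      (fun p : ℕ × Fin N => Z p.1 p.2) p) (sampleLaw D p) P := by
    rintro (p | p)
    · exact h.reward_law _ _
    · exact h.noise_law _ _
  have := h.indep.hasLaw_infinitePi hX (aemeasurable_pi_iff.2 fun p => (hX p).aemeasurable)
  convert this using 1
  ext ω p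
  rcases p with p | p <;> rfl

theorem expectedPulls_eq (h : IsBanditSample P D X Z) (hsel : Measurable sel) (T : ℕ)
    (i : Fin N) :
    expectedPulls P b c sel X Z T i = ∫ y, (pullCount b c sel T i y : ℝ) ∂jointLaw D := by
  rw [← h.hasLaw.map_eq, integral_map h.hasLaw.aemeasurable]
  · rfl
  · rw [h.hasLaw.map_eq]
    exact (integrable_pullCount hsel T i).aestronglyMeasurable

theorem expectedRegret_eq (h : IsBanditSample P D X Z) (hsel : Measurable sel)
    (hD : ∀ i, ∀ᵐ y ∂(D i), y ∈ Set.Icc (0 : ℝ) 1) (T : ℕ) :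
    expectedRegret P D b c sel X Z T = ∑ i, gap D i * expectedPulls P b c sel X Z T i := by
  have h1 : ∫ ω, ∑ t ∈ Finset.range T,
      rewardAt b c sel (fun j k => X j k ω) (fun s j => Z s j ω) t ∂P =
      ∫ y, ∑ t ∈ Finset.range T, rewardAt b c sel (rewards y) (noises y) t ∂jointLaw D := by
    have hm : Measurable fun y : SampleIndex N → ℝ =>
        ∑ t ∈ Finset.range T, rewardAt b c sel (rewards y) (noises y) t := by
      simp_rw [sum_rewardAt_eq]
      exact Finset.measurable_fun_sum _ fun i _ => Finset.measurable_fun_sum _ fun k _ =>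
        (measurable_pi_apply _).indicator (measurableSet_lt_pullCount hsel T k i)
    rw [← h.hasLaw.map_eq, integral_map h.hasLaw.aemeasurable hm.aestronglyMeasurable]
    rfl
  rw [expectedRegret, h1, integral_sum_rewardAt hsel hD]
  simp_rw [expectedPulls_eq h hsel, gap, sub_mul]
  rw [Finset.sum_sub_distrib, ← Finset.mul_sum, sum_integral_pullCount hsel]

end Transfer

theorem armMean_le_bestMean (D : Fin N → Measure ℝ) (i : Fin N) : armMean D i ≤ bestMean D :=
  le_ciSup (Set.finite_range _).bddAbove i

theorem gap_nonneg (D : Fin N → Measure ℝ) (i : Fin N) : 0 ≤ gap D i :=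
  sub_nonneg.2 (armMean_le_bestMean D i)

theorem exists_armMean_eq_bestMean (hN : 1 ≤ N) (D : Fin N → Measure ℝ) :
    ∃ a, armMean D a = bestMean D := by
  have : Nonempty (Fin N) := ⟨⟨0, hN⟩⟩
  exact exists_eq_ciSup_of_finite

theorem gap_le_one (hN : 1 ≤ N) (hD : ∀ i, ∀ᵐ y ∂(D i), y ∈ Set.Icc (0 : ℝ) 1) (i : Fin N) :
    gap D i ≤ 1 := by
  obtain ⟨a, ha⟩ := exists_armMean_eq_bestMean hN D
  rw [gap, ← ha]
  linarith [(armMean_mem_Icc (hD a)).2, (armMean_mem_Icc (hD i)).1]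

end Regret

/-! ### From pull bounds to regret bounds. -/

/-- From the bound on the pulls to the problem-dependent bound for one arm. -/
theorem gap_mul_pulls_le {c S Δ : ℝ} (hc : 1 ≤ c) (hΔ : 0 < Δ) (hΔ1 : Δ ≤ 1)
    (hS : 4 < S * Δ ^ 2) :
    Δ * (14 / Δ ^ 2 + 5130 * c / Δ ^ 2 * Real.log (S * Δ ^ 2)) ≤
      30000 * (c * Real.log S / Δ) := by
  have hS4 : 4 < S := by
    have : 0 < S := by
      by_contra h
      nlinarith [sq_nonneg Δ]
    nlinarith
  have hle : S * Δ ^ 2 ≤ S := mul_le_of_le_one_right (by linarith) (by nlinarith)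
  have hlog : Real.log (S * Δ ^ 2) ≤ Real.log S := Real.log_le_log (by linarith) hle
  have h1 : 1 ≤ Real.log S := by
    rw [Real.le_log_iff_exp_le (by linarith)]
    linarith [Real.exp_one_lt_d9]
  have e : Δ * (14 / Δ ^ 2 + 5130 * c / Δ ^ 2 * Real.log (S * Δ ^ 2)) =
      (14 + 5130 * (c * Real.log (S * Δ ^ 2))) / Δ := by field_simp
  rw [e, mul_div_assoc', div_le_div_iff_of_pos_right hΔ]
  have h2 : c * Real.log (S * Δ ^ 2) ≤ c * Real.log S := by gcongr
  have h3 : 1 ≤ c * Real.log S := by nlinarith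
  linarith

/-- From the bound on the pulls to the problem-independent bound for an arm with a large gap. -/
theorem gap_mul_pulls_le_of_le {n : ℕ} (hn : 2 ≤ n) {c S Δ : ℝ} (hc : 1 ≤ c) (hS : 0 < S)
    (hΔ : √(n * Real.log n / S) ≤ Δ) :
    Δ * (14 / Δ ^ 2 + 5130 * c / Δ ^ 2 * Real.log (S * Δ ^ 2)) ≤
      26000 * c * Real.log n * (√(n * Real.log n / S))⁻¹ := by
  have hn' : (2 : ℝ) ≤ n := by exact_mod_cast hn
  have hlogn : 0.69 ≤ Real.log n := by
    have := Real.log_le_log (by norm_num) hn'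
    linarith [Real.log_two_gt_d9]
  set d := √(n * Real.log n / S) with hd
  have hd0 : 0 < d := by positivity
  have hΔ0 : 0 < Δ := hd0.trans_le hΔ
  -- In units of the threshold `d`, `log (S * Δ ^ 2)` is at most `2 log n + 2 w`; the factor `1/w`
  -- in the cost and `log n ≥ 0.69` absorb the linear term.
  set w := Δ / d with hw
  have hw1 : 1 ≤ w := by rw [hw, le_div_iff₀ hd0, one_mul]; exact hΔ
  have hΔw : Δ = d * w := by rw [hw]; field_simp
  have hSd : S * Δ ^ 2 = n * (Real.log n * w ^ 2) := by
    rw [hΔw, mul_pow, hd, Real.sq_sqrt (by positivity)]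
    field_simp
  have hlog : Real.log (S * Δ ^ 2) ≤ 2 * Real.log n + 2 * w := by
    rw [hSd, Real.log_mul (by positivity) (by positivity),
      Real.log_mul (by positivity) (by positivity), Real.log_pow]
    have h1 : Real.log (Real.log n) ≤ Real.log n :=
      (Real.log_le_sub_one_of_pos (by linarith)).trans (by linarith)
    have h2 : Real.log w ≤ w := (Real.log_le_sub_one_of_pos (by linarith)).trans (by linarith)
    push_cast
    linarith
  have e : Δ * (14 / Δ ^ 2 + 5130 * c / Δ ^ 2 * Real.log (S * Δ ^ 2)) =
      (14 + 5130 * (c * Real.log (S * Δ ^ 2))) / (d * w) := by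
    rw [← hΔw]; field_simp
  rw [e, ← div_eq_mul_inv, div_le_div_iff₀ (by positivity) hd0]
  have h3 : c * Real.log (S * Δ ^ 2) ≤ c * (2 * Real.log n + 2 * w) := by gcongr
  have h4 : 14 + 5130 * (c * (2 * Real.log n + 2 * w)) ≤ 26000 * c * Real.log n * w := by
    have h5 : c * Real.log n ≤ c * Real.log n * w := le_mul_of_one_le_right (by positivity) hw1
    have h6 : 0.69 * (c * w) ≤ c * Real.log n * w := by
      calc 0.69 * (c * w) = c * 0.69 * w := by ring
        _ ≤ _ := by gcongr
    have h7 : 1 ≤ c * w := one_le_mul_of_one_le_of_one_le hc hw1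
    linarith
  calc _ ≤ (26000 * c * Real.log n * w) * d := by gcongr; linarith
    _ = _ := by ring

/-- The threshold balances the two costs: `d · S` for small gaps and `n log n / d` for large gaps
(`sqrt_split_inv`) are the same number. -/
theorem sqrt_split {n : ℕ} {S : ℝ} (hS : 0 < S) :
    √(n * Real.log n / S) * S = √(n * S * Real.log n) := by
  have : (n : ℝ) * S * Real.log n = n * Real.log n / S * S ^ 2 := by field_simp
  rw [this, Real.sqrt_mul' _ (sq_nonneg S), Real.sqrt_sq hS.le]

theorem sqrt_split_inv {n : ℕ} (hn : 2 ≤ n) {S : ℝ} (hS : 0 < S) :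
    n * (Real.log n * (√(n * Real.log n / S))⁻¹) = √(n * S * Real.log n) := by
  have hn' : (2 : ℝ) ≤ n := by exact_mod_cast hn
  have hlogn : 0 < Real.log n := Real.log_pos (by linarith)
  have h : 0 < √(n * Real.log n / S) := by positivity
  rw [← sqrt_split hS, ← mul_assoc, ← div_eq_mul_inv, div_eq_iff h.ne', mul_right_comm,
    Real.mul_self_sqrt (by positivity)]
  field_simp

end ModifiedTS

theorem mainTheorem3 :
    ∃ C : ℝ, 0 < C ∧
      ∀ (N b T : ℕ) (c : ℝ) (D : Fin N → MeasureTheory.Measure ℝ)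
        (sel : (Fin N → ℝ) → Fin N)
        (Ω : Type*) [MeasurableSpace Ω] (P : MeasureTheory.Measure Ω)
        [MeasureTheory.IsProbabilityMeasure P]
        (X : Fin N → ℕ → Ω → ℝ) (Z : ℕ → Fin N → Ω → ℝ),
        1 ≤ N →
        1 ≤ c →
        (∀ i, MeasureTheory.IsProbabilityMeasure (D i)) →
        (∀ i, ∀ᵐ y ∂(D i), y ∈ Set.Icc (0 : ℝ) 1) →
        ModifiedTS.IsArgmaxRule sel →
        ModifiedTS.IsBanditSample P D X Z →
        b * N < T →
        (∀ i, 0 < ModifiedTS.gap D i →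
          (b : ℝ) * N + 4 / ModifiedTS.gap D i ^ 2 < T) →
        (∀ i, 0 < ModifiedTS.gap D i →
          ModifiedTS.expectedPulls P b c sel X Z T i ≤
            b + 14 / ModifiedTS.gap D i ^ 2 +
              5130 * c / ModifiedTS.gap D i ^ 2 *
                Real.log (((T : ℝ) - b * N) * ModifiedTS.gap D i ^ 2)) ∧
        ModifiedTS.expectedRegret P D b c sel X Z T ≤
          b * N + C * (c * √(N * ((T : ℝ) - b * N) * Real.log N)) ∧
        ModifiedTS.expectedRegret P D b c sel X Z T ≤
          b * N + ∑ i with 0 < ModifiedTS.gap D i,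
            C * (c * Real.log ((T : ℝ) - b * N) / ModifiedTS.gap D i) := by
  refine ⟨30000, by norm_num, ?_⟩
  intro N b T c D sel Ω _ P _ X Z hN hc hDp hD hsel hsample hT hTgap
  have hm := hsel.measurable
  obtain ⟨a, ha⟩ := ModifiedTS.exists_armMean_eq_bestMean hN D
  have hTr : (b : ℝ) * N < T := by exact_mod_cast hT
  have hS : 0 < (T : ℝ) - b * N := sub_pos.2 hTr
  have hSgap : ∀ i, 0 < ModifiedTS.gap D i → 4 < ((T : ℝ) - b * N) * ModifiedTS.gap D i ^ 2 := by
    intro i hi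
    have h := hTgap i hi
    rw [← lt_sub_iff_add_lt', div_lt_iff₀ (by positivity)] at h
    exact h
  have hpulls : ∀ i, 0 < ModifiedTS.gap D i →
      ModifiedTS.expectedPulls P b c sel X Z T i ≤
        b + 14 / ModifiedTS.gap D i ^ 2 +
          5130 * c / ModifiedTS.gap D i ^ 2 *
            Real.log (((T : ℝ) - b * N) * ModifiedTS.gap D i ^ 2) := by
    intro i hi
    rw [ModifiedTS.expectedPulls_eq hsample hm]
    exact ModifiedTS.integral_pullCount_le hc hsel hD hT.le i a hi
      (by rw [ha, ModifiedTS.gap]; ring) (hSgap i hi)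
  have hge : ∀ i, 0 ≤ ModifiedTS.expectedPulls P b c sel X Z T i - b := by
    intro i
    rw [ModifiedTS.expectedPulls_eq hsample hm]
    exact sub_nonneg.2 (ModifiedTS.le_integral_pullCount hm hT.le i)
  have hsum : ∑ i, (ModifiedTS.expectedPulls P b c sel X Z T i - b) = (T : ℝ) - b * N := by
    simp_rw [ModifiedTS.expectedPulls_eq hsample hm]
    rw [Finset.sum_sub_distrib, ModifiedTS.sum_integral_pullCount hm]
    simp [mul_comm]
  have hregret : ModifiedTS.expectedRegret P D b c sel X Z T ≤ b * N +
      ∑ i, ModifiedTS.gap D i * (ModifiedTS.expectedPulls P b c sel X Z T i - b) := by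
    rw [ModifiedTS.expectedRegret_eq hsample hm hD]
    -- Gaps are at most `1`, so the `b` pre-pulls of each arm cost at most `b`.
    have h1 : ∑ i, ModifiedTS.gap D i * (b : ℝ) ≤ ∑ _i : Fin N, (b : ℝ) :=
      Finset.sum_le_sum fun i _ =>
        mul_le_of_le_one_left (Nat.cast_nonneg b) (ModifiedTS.gap_le_one hN hD i)
    simp only [mul_sub, Finset.sum_sub_distrib]
    simp only [Finset.sum_const, Finset.card_univ, Fintype.card_fin, nsmul_eq_mul] at h1
    linarith
  have hexcess : ∀ i, 0 < ModifiedTS.gap D i →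
      ModifiedTS.gap D i * (ModifiedTS.expectedPulls P b c sel X Z T i - b) ≤
        ModifiedTS.gap D i * (14 / ModifiedTS.gap D i ^ 2 + 5130 * c / ModifiedTS.gap D i ^ 2 *
            Real.log (((T : ℝ) - b * N) * ModifiedTS.gap D i ^ 2)) := by
    intro i hi
    have := hpulls i hi
    gcongr
    linarith
  refine ⟨hpulls, hregret.trans (add_le_add_right ?_ _), hregret.trans (add_le_add_right ?_ _)⟩
  -- For one arm `log N` vanishes and the threshold degenerates, but the only arm is optimal.
  · rcases hN.eq_or_lt with hN1 | hN2
    · subst hN1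
      have h0 : ∀ i, ModifiedTS.gap D i = 0 := fun i => by
        rw [ModifiedTS.gap, ← ha, Subsingleton.elim i a, sub_self]
      simp [h0]
    · have hlog : 0 ≤ Real.log N := Real.log_natCast_nonneg N
      have hterm : ∀ i, ModifiedTS.gap D i * (ModifiedTS.expectedPulls P b c sel X Z T i - b) ≤
          √(N * Real.log N / ((T : ℝ) - b * N)) *
            (ModifiedTS.expectedPulls P b c sel X Z T i - b) +
          26000 * c * Real.log N * (√(N * Real.log N / ((T : ℝ) - b * N)))⁻¹ := by
        intro i
        -- Small gaps pay the threshold per excess pull, and those pulls total `T - bN`; large gaps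
        -- use the pull bound. Each summand keeps both costs, so the sum needs no case split.
        rcases le_or_gt (ModifiedTS.gap D i) (√(N * Real.log N / ((T : ℝ) - b * N))) with h | h
        · exact (mul_le_mul_of_nonneg_right h (hge i)).trans
            (le_add_of_nonneg_right (by positivity))
        · exact ((hexcess i ((Real.sqrt_nonneg _).trans_lt h)).trans
            (ModifiedTS.gap_mul_pulls_le_of_le hN2 hc hS h.le)).trans
            (le_add_of_nonneg_left (mul_nonneg (Real.sqrt_nonneg _) (hge i)))
      refine (Finset.sum_le_sum fun i _ => hterm i).trans ?_
      rw [Finset.sum_add_distrib, ← Finset.mul_sum, hsum, ModifiedTS.sqrt_split hS,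
        Finset.sum_const, Finset.card_univ, Fintype.card_fin, nsmul_eq_mul]
      have e : (N : ℝ) * (26000 * c * Real.log N * (√(N * Real.log N / ((T : ℝ) - b * N)))⁻¹) =
          26000 * (c * √(N * ((T : ℝ) - b * N) * Real.log N)) := by
        rw [← ModifiedTS.sqrt_split_inv hN2 hS]; ring
      rw [e]
      have := le_mul_of_one_le_left (Real.sqrt_nonneg (N * ((T : ℝ) - b * N) * Real.log N)) hc
      have : 0 ≤ c * √(N * ((T : ℝ) - b * N) * Real.log N) := by positivity
      linarith
  · rw [Finset.sum_filter]
    refine Finset.sum_le_sum fun i _ => ?_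
    split_ifs with hi
    · exact (hexcess i hi).trans (ModifiedTS.gap_mul_pulls_le hc hi
        (ModifiedTS.gap_le_one hN hD i) (hSgap i hi))
    · rw [le_antisymm (not_lt.1 hi) (ModifiedTS.gap_nonneg D i), zero_mul]
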